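/- \textbf{Setting.} A three-phase microgrid has finitely many nodes $n$ with phases $\mathcal P_n\subseteq\{a,b,c\}$, directed lines $(m,n)\in\mathcal E$ with phases $\mathcal P_{mn}$, a set $\mathcal E_R\subseteq\mathcal E$ of lines with switches, a set $\mathcal D$ of phase-node pairs $(\phi,n)$, $\phi\in\mathcal P_n$, carrying loads or generators (with $\bar{\mathcal D}$ the remaining pairs), and distributed generation (DG) units at some pairs. Let $\xi_{mn}\in\mathbb R^{2|\mathcal P_{mn}|}$ be the real and imaginary parts of the currents on line $(m,n)$, $\xi$ all of them, and $\sigma=\{(P_{G_n}^\phi,Q_{G_n}^\phi)\}$ the DG powers, which are zero at pairs without DG unit. Let $A_n^\phi\xi\in\mathbb R^2$ be the current injected at phase $\phi$ of node $n$ by Kirchhoff's current law (outgoing minus incoming line currents of phase $\phi$), $\varphi^\phi=M_N(\cos\theta^\phi,\sin\theta^\phi)^{\mathsf T}$ and $\bar\varphi^\phi=M_N(\sin\theta^\phi,-\cos\theta^\phi)^{\mathsf T}$, where $M_N>0$ and $\theta^\phi$ are the magnitude and angle of the nominal voltage, and let $P_n^\phi(k),Q_n^\phi(k)$, $k=1,\dots,K$,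 $K\ge1$, be the samples of the net uncertain active and reactive power (renewable generation minus load, plus $(\varphi^\phi)^{\mathsf T}\epsilon(k)$, resp. $(\bar\varphi^\phi)^{\mathsf T}\epsilon(k)$, with $\epsilon(k)$ the sampled error of the approximate current-power relation). \textbf{Centralized problem (MR3).} Minimize $C(\xi,\sigma)+\sum_{(m,n)\in\mathcal E_R}\lambda_{mn}\|\xi_{mn}\|_2$, with $\lambda_{mn}\ge 0$, subject to (i) $(\varphi^\phi)^{\mathsf T}A_n^\phi\xi\le P_{G_n}^\phi+\min_kP_n^\phi(k)$ and $(\bar\varphi^\phi)^{\mathsf T}A_n^\phi\xi\le Q_{G_n}^\phi+\min_kQ_n^\phi(k)$ for $(\phi,n)\in\mathcal D$; (ii) $|I_{mn}^\phi|^2\le (I_{mn}^{\max})^2$ for every line $(m,n)$ and $\phi\in\mathcal P_{mn}$, where $|I_{mn}^\phi|^2$ is the sum of the squares of the two entries of $\xi_{mn}$ of phase $\phi$; (iii) $A_n^\phi\xi=0$ for $(\phi,n)\in\bar{\mathcal D}$; (iv) lower and upper limits (possibly infinite) on the DG powers. \textbf{Decomposition.} The nodes are partitioned into areas $\mathcal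 A^{(1)},\dots,\mathcal A^{(L)}$. For $\ell\neq j$ let $\mathcal I(\ell,j)=\mathcal I(j,\ell)$ be the set of lines with one end in $\mathcal A^{(\ell)}$ and the other in $\mathcal A^{(j)}$; all these lines lie in $\mathcal E_R$. Let $\mathcal N^{(\ell)}=\{j\ne\ell:\mathcal I(\ell,j)\neq\emptyset\}$, let $\mathcal E^{(\ell)}$ be the lines with at least one end in $\mathcal A^{(\ell)}$ and $\mathcal E_R^{(\ell)}$ the lines of $\mathcal E_R$ with both ends in $\mathcal A^{(\ell)}$. Write $\xi^{(\ell)}$ for currents on $\mathcal E^{(\ell)}$, $\xi^{(\ell)}_{\mathcal I(\ell,j)}$ for their part on $\mathcal I(\ell,j)$, and $s^{(\ell)}$ for the powers of the DG units in $\mathcal A^{(\ell)}$. Let $\mathcal F^{(\ell)}$ be the set of $(\xi^{(\ell)},s^{(\ell)})$ satisfying (i), (iii) at the nodes of $\mathcal A^{(\ell)}$, (ii) on $\mathcal E^{(\ell)}$, and (iv) for the units in $\mathcal A^{(\ell)}$. Suppose that $$C(\xi,\sigma)=\sum_{\ell}C^{(\ell)}(\xi^{(\ell)},s^{(\ell)})+\sum_{\ell}\sum_{j>\ell}C_{\mathcal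 I(\ell,j)}(\xi_{\mathcal I(\ell,j)}),$$ where on the right $\xi^{(\ell)},s^{(\ell)},\xi_{\mathcal I(\ell,j)}$ are the corresponding parts of $\xi,\sigma$, and all $C^{(\ell)}$ and $C_{\mathcal I(\ell,j)}$ are real-valued and convex on the whole space. \textbf{Algorithm.} For $\kappa>0$, from arbitrary $\xi^{(\ell)}(0),s^{(\ell)}(0),\chi_{\mathcal I(\ell,j)}(0)$, for $i=0,1,\dots$ (with $\chi_{\mathcal I(\ell,j)}=\chi_{\mathcal I(j,\ell)}$ and likewise for $\mu$), put $w_{\ell j}(i)=\xi^{(\ell)}_{\mathcal I(\ell,j)}(i)+\xi^{(j)}_{\mathcal I(\ell,j)}(i)+\chi_{\mathcal I(\ell,j)}(i)$. [S1a$'$] For each $\ell$, $(\xi^{(\ell)}(i+1),s^{(\ell)}(i+1))$ is a minimizer over $\mathcal F^{(\ell)}$ of $$C^{(\ell)}(\xi^{(\ell)},s^{(\ell)})+\sum_{(m,n)\in\mathcal E_R^{(\ell)}}\lambda_{mn}\|\xi_{mn}^{(\ell)}\|_2+\sum_{j\in\mathcal N^{(\ell)}}\Big[\gamma^{(\ell)}_{\mathcal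 I(\ell,j)}(i)^{\mathsf T}\xi^{(\ell)}_{\mathcal I(\ell,j)}+\tfrac\kappa2\|\xi^{(\ell)}_{\mathcal I(\ell,j)}\|_2^2-\tfrac\kappa3(\xi^{(\ell)}_{\mathcal I(\ell,j)})^{\mathsf T}w_{\ell j}(i)\Big].$$ [S1b$'$] For each $\ell<j$, $\chi_{\mathcal I(\ell,j)}(i+1)$ minimizes $$C_{\mathcal I(\ell,j)}(\chi)+\sum_{(m,n)\in\mathcal I(\ell,j)}\lambda_{mn}\|\chi_{mn}\|_2+\tfrac\kappa2\|\chi\|_2^2-\chi^{\mathsf T}\big[\mu_{\mathcal I(\ell,j)}(i)+\tfrac\kappa3w_{\ell j}(i)\big]$$ over the $\chi$ satisfying the current limits (ii) on $\mathcal I(\ell,j)$. [S2$'$] For all $\ell\ne j$, resp. all $\ell<j$, $$\gamma^{(\ell)}_{\mathcal I(\ell,j)}(i+1)=\gamma^{(\ell)}_{\mathcal I(\ell,j)}(i)+\tfrac\kappa3\big(2\xi^{(\ell)}_{\mathcal I(\ell,j)}(i+1)-\xi^{(j)}_{\mathcal I(\ell,j)}(i+1)-\chi_{\mathcal I(\ell,j)}(i+1)\big),$$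 $$\mu_{\mathcal I(\ell,j)}(i+1)=\mu_{\mathcal I(\ell,j)}(i)+\tfrac\kappa3\big(\xi^{(\ell)}_{\mathcal I(\ell,j)}(i+1)+\xi^{(j)}_{\mathcal I(\ell,j)}(i+1)-2\chi_{\mathcal I(\ell,j)}(i+1)\big).$$ \textbf{Proposition.} Suppose that (MR3) has a unique optimal solution $(\xi_{\rm opt},\sigma_{\rm opt})$, and that it has a feasible point at which all the current limits (ii) hold strictly. Suppose that the dual variables are initialized at $\gamma^{(\ell)}_{\mathcal I(\ell,j)}(0)=\gamma^{(j)}_{\mathcal I(\ell,j)}(0)=\mu_{\mathcal I(\ell,j)}(0)=0$. Then, for any $\kappa>0$, the steps [S1a$'$]--[S2$'$] can be carried out for all $i$ from every such initialization, and for every sequence of iterates obtained from them, $\xi^{(\ell)}(i)$, $s^{(\ell)}(i)$, $\chi_{\mathcal I(\ell,j)}(i)$, $\gamma^{(\ell)}_{\mathcal I(\ell,j)}(i)$ and $\mu_{\mathcal I(\ell,j)}(i)$ converge as $i\to\infty$, and for every $\ell$ the limit of $(\xi^{(\ell)}(i),s^{(\ell)}(i))$ is the part of $(\xi_{\rm opt},\sigma_{\rm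 opt})$ that belongs to area $\ell$. -/

import Mathlib

open Set Filter Topology

noncomputable section

/-- The three phases `a`, `b`, `c`. -/
abbrev Phase : Type := Fin 3

/-- Data of a three-phase microgrid with `N` nodes that is partitioned into `L` areas, together
with `K` samples of the forecasting errors. A pair `(re, im)` or `(active, reactive)` is indexed
by `Fin 2`. -/
structure Microgrid (N L K : ℕ) where
  /-- directed distribution lines `(m, n)` -/
  lines : Finset (Fin N × Fin N)
  /-- phases of a line -/
  linePhases : Fin N × Fin N → Finset Phase
  /-- phases of a node -/
  nodePhases : Fin N → Finset Phase
  /-- lines equipped with controllable switches -/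
  switchable : Finset (Fin N × Fin N)
  switchable_subset : switchable ⊆ lines
  /-- the area that a node belongs to -/
  area : Fin N → Fin L
  /-- every line that connects two different areas has a switch -/
  switchable_of_tie : ∀ e ∈ lines, area e.1 ≠ area e.2 → e ∈ switchable
  /-- node-phase pairs where loads and/or generators are located -/
  demand : Finset (Fin N × Phase)
  demand_phase : ∀ p ∈ demand, p.2 ∈ nodePhases p.1
  /-- node-phase pairs with a conventional distributed generation (DG) unit -/
  dgs : Finset (Fin N × Phase)
  dgs_phase : ∀ p ∈ dgs, p.2 ∈ nodePhases p.1
  /-- lower limits of the DG powers (`⊥` if there is none) -/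
  dgMin : Fin N × Phase → Fin 2 → EReal
  /-- upper limits of the DG powers (`⊤` if there is none) -/
  dgMax : Fin N × Phase → Fin 2 → EReal
  /-- cap on the current magnitude on a line -/
  Imax : Fin N × Fin N → ℝ
  /-- magnitude of the nominal line-to-ground voltage -/
  nomMag : ℝ
  nomMag_pos : 0 < nomMag
  /-- angle of the nominal line-to-ground voltage on each phase -/
  nomAngle : Phase → ℝ
  samples_pos : 0 < K
  /-- number of renewable energy sources at a node and phase -/
  numRES : Fin N → Phase → ℕ
  /-- samples of the power supplied by each renewable source -/
  resPower : (n : Fin N) → (φ : Phase) → Fin (numRES n φ) → Fin K → Fin 2 → ℝ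
  /-- samples of the load -/
  load : Fin N → Phase → Fin K → Fin 2 → ℝ
  /-- samples of the error in the approximate current-power relation -/
  err : Fin N → Phase → Fin K → Fin 2 → ℝ

namespace Microgrid

variable {N L K : ℕ} (M : Microgrid N L K)

/-- The lines of the microgrid, as a type. -/
abbrev Line : Type := {e : Fin N × Fin N // e ∈ M.lines}

/-- Real and imaginary parts of the phase currents on one line: the vector `ξ_mn`. -/
abbrev LineVec (e : M.Line) : Type := EuclideanSpace ℝ (Fin 2 × M.linePhases e.1)

/-- Stacked currents on a set `S` of lines. -/
abbrev Vec (S : Finset M.Line) : Type := (e : S) → M.LineVec e.1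

/-- Stacked active and reactive powers of a set `T` of DG units. -/
abbrev DGVec (_M : Microgrid N L K) (T : Finset (Fin N × Phase)) : Type := T → Fin 2 → ℝ

/-- Sub-vector of currents belonging to a subset of lines. -/
def sub {S S' : Finset M.Line} (h : S ⊆ S') (x : M.Vec S') : M.Vec S :=
  fun e => x ⟨e.1, h e.2⟩

/-- Inner product of two stacked current vectors. -/
def ip {S : Finset M.Line} (x y : M.Vec S) : ℝ := ∑ e, inner ℝ (x e) (y e)

/-- Squared Euclidean norm of a stacked current vector. -/
def normSq {S : Finset M.Line} (x : M.Vec S) : ℝ := ∑ e, ‖x e‖ ^ 2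

/-! ### Areas -/

/-- Nodes of area `ℓ`. -/
def areaNodes (ℓ : Fin L) : Finset (Fin N) := {n | M.area n = ℓ}

/-- Lines within area `ℓ`, plus the lines connecting area `ℓ` to its neighbours. -/
def areaLines (ℓ : Fin L) : Finset M.Line := {e | M.area e.1.1 = ℓ ∨ M.area e.1.2 = ℓ}

/-- DG units in area `ℓ`. -/
def areaDGs (ℓ : Fin L) : Finset (Fin N × Phase) := {p ∈ M.dgs | M.area p.1 = ℓ}

/-- All lines connecting two different areas. -/
def ties : Finset M.Line := {e | M.area e.1.1 ≠ M.area e.1.2}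

/-- The line(s) connecting the areas `ℓ` and `j`, in either direction. -/
def tie (ℓ j : Fin L) : Finset M.Line :=
  {e | ℓ ≠ j ∧ ((M.area e.1.1 = ℓ ∧ M.area e.1.2 = j) ∨ (M.area e.1.1 = j ∧ M.area e.1.2 = ℓ))}

/-- Neighbouring areas of area `ℓ`. -/
def neighbors (ℓ : Fin L) : Finset (Fin L) := {j | (M.tie ℓ j).Nonempty}

theorem tie_sub_left (ℓ j : Fin L) : M.tie ℓ j ⊆ M.areaLines ℓ := by
  intro e; simp only [tie, areaLines, Finset.mem_filter]; tauto

theorem tie_sub_right (ℓ j : Fin L) : M.tie ℓ j ⊆ M.areaLines j := by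
  intro e; simp only [tie, areaLines, Finset.mem_filter]; tauto

theorem tie_sub_ties (ℓ j : Fin L) : M.tie ℓ j ⊆ M.ties := by
  intro e; simp only [tie, ties, Finset.mem_filter]
  rintro ⟨h, hne, ⟨rfl, rfl⟩ | ⟨rfl, rfl⟩⟩
  · exact ⟨h, hne⟩
  · exact ⟨h, hne.symm⟩

theorem areaDGs_sub (ℓ : Fin L) : M.areaDGs ℓ ⊆ M.dgs := Finset.filter_subset _ _

/-- Optimization variables of the centralized problem: all line currents and all DG powers. -/
abbrev Var : Type := M.Vec Finset.univ × M.DGVec M.dgs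

/-- Optimization variables of area `ℓ`. -/
abbrev AreaVar (ℓ : Fin L) : Type := M.Vec (M.areaLines ℓ) × M.DGVec (M.areaDGs ℓ)

/-- The part of the centralized variables that area `ℓ` works with. -/
def toArea (ℓ : Fin L) (x : M.Var) : M.AreaVar ℓ :=
  (M.sub (Finset.subset_univ _) x.1, fun g => x.2 ⟨g.1, M.areaDGs_sub ℓ g.2⟩)

/-! ### Constraints -/

/-- Phase-`φ` current (`i = 0`: real part, `i = 1`: imaginary part) on a line; zero if the line
does not have that phase. -/
def phaseCurrent {e : M.Line} (v : M.LineVec e) (φ : Phase) (i : Fin 2) : ℝ :=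
  if h : φ ∈ M.linePhases e.1 then v (i, ⟨φ, h⟩) else 0

/-- Current injected at phase `φ` of node `n`, from Kirchhoff's current law: the outgoing minus the
incoming line currents. -/
def injection {S : Finset M.Line} (x : M.Vec S) (n : Fin N) (φ : Phase) (i : Fin 2) : ℝ :=
  (∑ e : S, if e.1.1.1 = n ∧ φ ∈ M.nodePhases n then M.phaseCurrent (x e) φ i else 0)
    - ∑ e : S, if e.1.1.2 = n ∧ φ ∈ M.nodePhases n then M.phaseCurrent (x e) φ i else 0

/-- With `V = M_N exp(j θ)` the nominal voltage of phase `φ` and `I` a current with real and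
imaginary parts `u 0, u 1`: the real part (`i = 0`) and imaginary part (`i = 1`) of `V I^*`. -/
def nomPower (φ : Phase) (u : Fin 2 → ℝ) : Fin 2 → ℝ :=
  ![M.nomMag * Real.cos (M.nomAngle φ) * u 0 + M.nomMag * Real.sin (M.nomAngle φ) * u 1,
    M.nomMag * Real.sin (M.nomAngle φ) * u 0 - M.nomMag * Real.cos (M.nomAngle φ) * u 1]

/-- The `k`-th sample of the net uncertain power at phase `φ` of node `n`. -/
def sample (n : Fin N) (φ : Phase) (k : Fin K) (i : Fin 2) : ℝ :=
  (∑ r, M.resPower n φ r k i) - M.load n φ k i + M.nomPower φ (M.err n φ k) i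

/-- Power supplied by the DG unit at phase `φ` of node `n`; zero if there is none. -/
def dgPower {T : Finset (Fin N × Phase)} (s : M.DGVec T) (n : Fin N) (φ : Phase) (i : Fin 2) : ℝ :=
  if h : (n, φ) ∈ T then s ⟨(n, φ), h⟩ i else 0

/-- Squared magnitude of the current on a line at one of its phases. -/
def magSq {e : M.Line} (v : M.LineVec e) (φ : M.linePhases e.1) : ℝ := v (0, φ) ^ 2 + v (1, φ) ^ 2

/-- The constraints on the currents of the lines `S` and the powers of the DG units `T`, with the
nodal constraints imposed at the nodes `A`. -/
structure Feasible (S : Finset M.Line) (T : Finset (Fin N × Phase)) (A : Finset (Fin N))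
    (x : M.Vec S × M.DGVec T) : Prop where
  /-- sampled load satisfaction, for active and reactive power -/
  loadSat : ∀ n ∈ A, ∀ φ, (n, φ) ∈ M.demand → ∀ i,
    M.nomPower φ (M.injection x.1 n φ) i ≤ M.dgPower x.2 n φ i + ⨅ k, M.sample n φ k i
  /-- limits on the current magnitudes -/
  magnitude : ∀ e : S, ∀ φ, M.magSq (x.1 e) φ ≤ M.Imax e.1.1 ^ 2
  /-- no current is injected where there is neither load nor generation -/
  zeroCurrent : ∀ n ∈ A, ∀ φ ∈ M.nodePhases n, (n, φ) ∉ M.demand → ∀ i, M.injection x.1 n φ i = 0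
  /-- limits of the DG units -/
  dgBox : ∀ g : T, ∀ i, M.dgMin g.1 i ≤ (x.2 g i : EReal) ∧ (x.2 g i : EReal) ≤ M.dgMax g.1 i

/-- Feasible set of the centralized problem. -/
def feasibleSet : Set M.Var := {x | M.Feasible Finset.univ M.dgs Finset.univ x}

/-- Feasible set of area `ℓ`. -/
def areaFeasibleSet (ℓ : Fin L) : Set (M.AreaVar ℓ) :=
  {x | M.Feasible (M.areaLines ℓ) (M.areaDGs ℓ) (M.areaNodes ℓ) x}

/-- Feasible set of the currents on the lines connecting areas `ℓ` and `j`. -/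
def tieFeasibleSet (ℓ j : Fin L) : Set (M.Vec (M.tie ℓ j)) :=
  {χ | ∀ e, ∀ φ, M.magSq (χ e) φ ≤ M.Imax e.1.1 ^ 2}

/-- There is a feasible operating point at which no line current is at its limit. -/
def Slater : Prop := ∃ x ∈ M.feasibleSet, ∀ e φ, M.magSq (x.1 e) φ < M.Imax e.1.1 ^ 2

/-! ### The centralized problem -/

/-- Group-Lasso regularization over the lines with switches. -/
def groupLasso (lam : M.Line → ℝ) (ξ : M.Vec Finset.univ) : ℝ :=
  ∑ e, if e.1.1 ∈ M.switchable then lam e.1 * ‖ξ e‖ else 0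

/-- `x` minimizes `f` over the set `S`. -/
def IsArgmin {α : Type*} (f : α → ℝ) (S : Set α) (x : α) : Prop := x ∈ S ∧ IsMinOn f S x

/-- `x` is an optimal solution of the centralized convex reconfiguration problem. -/
def IsOptimal (C : M.Var → ℝ) (lam : M.Line → ℝ) (x : M.Var) : Prop :=
  IsArgmin (fun y => C y + M.groupLasso lam y.1) M.feasibleSet x

/-! ### The decentralized algorithm -/

/-- Variables of the decentralized algorithm: per-area currents and DG powers, copies of the
currents on the lines connecting areas, and the multipliers. -/
structure State where
  ξ : (ℓ : Fin L) → M.Vec (M.areaLines ℓ)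
  s : (ℓ : Fin L) → M.DGVec (M.areaDGs ℓ)
  χ : M.Vec M.ties
  γ : (ℓ j : Fin L) → M.Vec (M.tie ℓ j)
  μ : M.Vec M.ties

variable {M}

/-- Area `ℓ`'s currents on the lines connecting it to area `j`. -/
def State.ξl (X : M.State) (ℓ j : Fin L) : M.Vec (M.tie ℓ j) := M.sub (M.tie_sub_left ℓ j) (X.ξ ℓ)

/-- Area `j`'s currents on the lines connecting it to area `ℓ`. -/
def State.ξr (X : M.State) (ℓ j : Fin L) : M.Vec (M.tie ℓ j) := M.sub (M.tie_sub_right ℓ j) (X.ξ j)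

/-- The copies of the currents on the lines connecting areas `ℓ` and `j`. -/
def State.χt (X : M.State) (ℓ j : Fin L) : M.Vec (M.tie ℓ j) := M.sub (M.tie_sub_ties ℓ j) X.χ

/-- The multipliers of the copies for the lines connecting areas `ℓ` and `j`. -/
def State.μt (X : M.State) (ℓ j : Fin L) : M.Vec (M.tie ℓ j) := M.sub (M.tie_sub_ties ℓ j) X.μ

/-- All dual variables are zero. -/
def State.DualZero (X : M.State) : Prop := (∀ ℓ j, X.γ ℓ j = 0) ∧ X.μ = 0

variable (M)

/-- Objective of the subproblem of area `ℓ`, given the current state `X`. -/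
def areaObj (Carea : (ℓ : Fin L) → M.AreaVar ℓ → ℝ) (lam : M.Line → ℝ) (κ : ℝ) (X : M.State)
    (ℓ : Fin L) (x : M.AreaVar ℓ) : ℝ :=
  Carea ℓ x
    + (∑ e : M.areaLines ℓ,
        if e.1.1 ∈ M.switchable ∧ M.area e.1.1.1 = ℓ ∧ M.area e.1.1.2 = ℓ
          then lam e.1 * ‖x.1 e‖ else 0)
    + ∑ j ∈ M.neighbors ℓ,
        (M.ip (X.γ ℓ j) (M.sub (M.tie_sub_left ℓ j) x.1)
          + κ / 2 * M.normSq (M.sub (M.tie_sub_left ℓ j) x.1)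
          - κ / 3 * M.ip (M.sub (M.tie_sub_left ℓ j) x.1) (X.ξl ℓ j + X.ξr ℓ j + X.χt ℓ j))

/-- Objective of the subproblem for the lines connecting areas `ℓ` and `j`, given the current
state `X`. -/
def tieObj (Ctie : (ℓ j : Fin L) → M.Vec (M.tie ℓ j) → ℝ) (lam : M.Line → ℝ) (κ : ℝ)
    (X : M.State) (ℓ j : Fin L) (χ : M.Vec (M.tie ℓ j)) : ℝ :=
  Ctie ℓ j χ + (∑ e, lam e.1 * ‖χ e‖) + κ / 2 * M.normSq χ
    - M.ip χ (X.μt ℓ j + (κ / 3) • (X.ξl ℓ j + X.ξr ℓ j + X.χt ℓ j))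

/-- One iteration of the simplified ADMM leads from `X` to `Y`. -/
structure Step (Carea : (ℓ : Fin L) → M.AreaVar ℓ → ℝ)
    (Ctie : (ℓ j : Fin L) → M.Vec (M.tie ℓ j) → ℝ) (lam : M.Line → ℝ) (κ : ℝ)
    (X Y : M.State) : Prop where
  area : ∀ ℓ, IsArgmin (M.areaObj Carea lam κ X ℓ) (M.areaFeasibleSet ℓ) (Y.ξ ℓ, Y.s ℓ)
  tie : ∀ ℓ j, ℓ < j → IsArgmin (M.tieObj Ctie lam κ X ℓ j) (M.tieFeasibleSet ℓ j) (Y.χt ℓ j)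
  dualγ : ∀ ℓ j, Y.γ ℓ j =
    X.γ ℓ j + (κ / 3) • ((2 : ℝ) • Y.ξl ℓ j - Y.ξr ℓ j - Y.χt ℓ j)
  dualμ : ∀ ℓ j, ℓ < j → Y.μt ℓ j =
    X.μt ℓ j + (κ / 3) • (Y.ξl ℓ j + Y.ξr ℓ j - (2 : ℝ) • Y.χt ℓ j)

end Microgrid

end

/-! The algorithm is an alternating direction method of multipliers (ADMM). Every area gets
variables of its own, and every tie line, that is, every line between two areas, gets the extra copy
`χ`. The centralized problem then reads: minimize a convex `F` over a closed convex set `D` subject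
to `B x ∈ Z`. Here `B` (`copies`) collects, for each tie line, the current according to the area of
its start, the area of its end and `χ`, and `Z` (`consensus`) consists of the equal triples.
Projecting onto `Z` means averaging three copies, whence the factor `κ / 3`. The multiplier `(γ, γ,
-μ)` is orthogonal to `Z` initially, being zero, and stays so (`augLagrangian_eq`,
`isADMM_of_step`).

Convergence (`IsADMM.tendsto`) rests on Fejér monotonicity: for a multiplier `v` and the solution
`y`, the quantity `‖u - v‖ ^ 2 + κ ^ 2 * ‖z - B y‖ ^ 2` drops in each iteration by at least the
squared lengths of the steps (`IsADMM.fejer`). Hence the residuals vanish and the objective is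
asymptotically at most optimal. Uniqueness of the solution turns this into convergence of `x`,
although `D` may be unbounded and `B` need not be injective (`tendsto_of_asymptotically_nonpos`). A
cluster point of the multipliers is again a multiplier, and monotonicity with respect to it makes
the whole sequence converge.

A multiplier exists (`exists_multiplier`) because the Slater point satisfies the current limits
strictly and all other constraints are polyhedral: Hahn-Banach separation handles the former,
Farkas' lemma the latter.

The subproblems are solvable since currents are bounded: a ray of an area's feasible set moves only
DG powers, and if the objective did not increase along it, the centralized problem would have a
second solution. -/

/-! ### Farkas' lemma and polyhedral sets. -/

/-- **Farkas' lemma** for finitely many linear functionals. -/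
theorem farkas {ι V : Type*} [AddCommGroup V] [Module ℝ V] (s : Finset ι)
    (a : ι → Module.Dual ℝ V) (φ : Module.Dual ℝ V)
    (h : ∀ x, (∀ i ∈ s, a i x ≤ 0) → φ x ≤ 0) :
    ∃ c : ι → ℝ, (∀ i, 0 ≤ c i) ∧ φ = ∑ i ∈ s, c i • a i := by
  classical
  induction s using Finset.induction_on generalizing a φ with
  | empty =>
    refine ⟨0, fun _ => le_rfl, ?_⟩
    ext x
    have h1 := h x (by simp)
    have h2 := h (-x) (by simp)
    simp only [map_neg] at h2
    simp only [Finset.sum_empty, LinearMap.zero_apply]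
    linarith
  | insert m s hm ih =>
    by_cases hs : ∀ x, (∀ i ∈ s, a i x ≤ 0) → φ x ≤ 0
    · obtain ⟨c, hc, hφ⟩ := ih a φ hs
      refine ⟨fun i => if i = m then 0 else c i, fun i => by dsimp only; split_ifs; exacts [le_rfl, hc i], ?_⟩
      rw [Finset.sum_insert hm, hφ]
      simp only [if_true, zero_smul, zero_add]
      refine Finset.sum_congr rfl fun i hi => ?_
      rw [if_neg (by rintro rfl; exact hm hi)]
    · push Not at hs
      obtain ⟨x₁, hx₁, hφ₁⟩ := hs
      have hm₁ : 0 < a m x₁ := by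
        by_contra hcon
        refine absurd (h x₁ fun i hi => ?_) (not_le.2 hφ₁)
        rcases Finset.mem_insert.1 hi with rfl | hi
        · exact not_lt.1 hcon
        · exact hx₁ i hi
      obtain ⟨x₀, hx₀, hφ₀, hm₀⟩ : ∃ x₀, (∀ i ∈ s, a i x₀ ≤ 0) ∧ 0 < φ x₀ ∧ a m x₀ = 1 := by
        refine ⟨(a m x₁)⁻¹ • x₁, fun i hi => ?_, ?_, ?_⟩
        · rw [map_smul, smul_eq_mul]
          exact mul_nonpos_of_nonneg_of_nonpos (inv_pos.2 hm₁).le (hx₁ i hi)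
        · rw [map_smul, smul_eq_mul]; positivity
        · rw [map_smul, smul_eq_mul, inv_mul_cancel₀ hm₁.ne']
      -- These are the functionals composed with the projection `x ↦ x - a m x • x₀` onto the kernel
      -- of `a m`, where constraint `m` holds automatically.
      obtain ⟨c, hc, hφ⟩ := ih (fun i => a i - a i x₀ • a m) (φ - φ x₀ • a m) (by
        intro x hx
        have key := h (x - a m x • x₀) (by
          intro i hi
          rcases Finset.mem_insert.1 hi with rfl | hi
          · simp [hm₀]
          · have := hx i hi
            simp only [LinearMap.sub_apply, LinearMap.smul_apply, smul_eq_mul] at this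
            simp only [map_sub, map_smul, smul_eq_mul]
            linarith)
        simp only [map_sub, map_smul, smul_eq_mul] at key
        simp only [LinearMap.sub_apply, LinearMap.smul_apply, smul_eq_mul]
        linarith)
      have hsum : ∑ i ∈ s, c i * a i x₀ ≤ 0 :=
        Finset.sum_nonpos fun i hi => mul_nonpos_of_nonneg_of_nonpos (hc i) (hx₀ i hi)
      -- The coefficient of `a m` restores what the projection removed. It is nonnegative because `φ
      -- x₀ > 0` while `a i x₀ ≤ 0` on `s`.
      refine ⟨fun i => if i = m then φ x₀ - ∑ i ∈ s, c i * a i x₀ else c i, fun i => ?_, ?_⟩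
      · dsimp only
        split_ifs
        · linarith
        · exact hc i
      · have h1 : ∑ i ∈ s, (if i = m then φ x₀ - ∑ i ∈ s, c i * a i x₀ else c i) • a i
            = ∑ i ∈ s, c i • a i := by
          refine Finset.sum_congr rfl fun i hi => ?_
          rw [if_neg (by rintro rfl; exact hm hi)]
        rw [Finset.sum_insert hm, h1]
        simp only [if_true]
        rw [sub_eq_iff_eq_add] at hφ
        generalize φ x₀ = q at hφ ⊢
        rw [hφ]
        simp only [smul_sub, Finset.sum_sub_distrib, smul_smul, ← Finset.sum_smul]
        module

/-- A finite intersection of closed half-spaces. -/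
def IsPolyhedral {E : Type*} [AddCommGroup E] [Module ℝ E] (P : Set E) : Prop :=
  ∃ T : Finset (Module.Dual ℝ E × ℝ), P = {x | ∀ p ∈ T, p.1 x ≤ p.2}

namespace IsPolyhedral

variable {E : Type*} [AddCommGroup E] [Module ℝ E]

theorem univ : IsPolyhedral (Set.univ : Set E) := ⟨∅, by simp⟩

theorem inter {P Q : Set E} (hP : IsPolyhedral P) (hQ : IsPolyhedral Q) :
    IsPolyhedral (P ∩ Q) := by
  classical
  obtain ⟨S, rfl⟩ := hP
  obtain ⟨T, rfl⟩ := hQ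
  refine ⟨S ∪ T, ?_⟩
  ext x
  simp only [mem_inter_iff, mem_ofPred_eq, Finset.mem_union]
  exact ⟨fun h p hp => hp.elim (h.1 p) (h.2 p),
    fun h => ⟨fun p hp => h p (.inl hp), fun p hp => h p (.inr hp)⟩⟩

theorem iInter {ι : Type*} [Finite ι] {P : ι → Set E} (hP : ∀ i, IsPolyhedral (P i)) :
    IsPolyhedral (⋂ i, P i) := by
  classical
  have := Fintype.ofFinite ι
  choose T hT using hP
  refine ⟨Finset.univ.biUnion T, ?_⟩
  ext x
  simp only [hT, mem_iInter, mem_ofPred_eq, Finset.mem_biUnion, Finset.mem_univ, true_and]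
  exact ⟨fun h p ⟨i, hp⟩ => h i p hp, fun h i p hp => h p ⟨i, hp⟩⟩

theorem all {ι : Type*} [Finite ι] {p : ι → E → Prop} (hP : ∀ i, IsPolyhedral {x | p i x}) :
    IsPolyhedral {x | ∀ i, p i x} := by
  rw [ofPred_forall]; exact iInter hP

theorem imp {p : Prop} {q : E → Prop} (hP : p → IsPolyhedral {x | q x}) :
    IsPolyhedral {x | p → q x} := by
  by_cases h : p
  · simpa [h] using hP h
  · simpa [h] using univ

theorem le {f : E → ℝ} (hf : IsLinearMap ℝ f) (b : ℝ) : IsPolyhedral {x | f x ≤ b} :=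
  ⟨{(hf.mk' f, b)}, by ext x; simp⟩

theorem ge {f : E → ℝ} (hf : IsLinearMap ℝ f) (b : ℝ) : IsPolyhedral {x | b ≤ f x} :=
  ⟨{(-hf.mk' f, -b)}, by ext x; simp⟩

theorem eq {f : E → ℝ} (hf : IsLinearMap ℝ f) (b : ℝ) : IsPolyhedral {x | f x = b} := by
  convert (le hf b).inter (ge hf b) using 1
  ext x
  exact le_antisymm_iff

theorem empty : IsPolyhedral (∅ : Set E) :=
  ⟨{(0, -1)}, by ext x; simp⟩

theorem coe_le {f : E → ℝ} (hf : IsLinearMap ℝ f) (b : EReal) :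
    IsPolyhedral {x | (f x : EReal) ≤ b} := by
  induction b with
  | bot => simpa using empty
  | top => simpa using univ
  | coe b => simpa using le hf b

theorem le_coe {f : E → ℝ} (hf : IsLinearMap ℝ f) (b : EReal) :
    IsPolyhedral {x | b ≤ (f x : EReal)} := by
  induction b with
  | bot => simpa using univ
  | top => simpa using empty
  | coe b => simpa using ge hf b

theorem preimage {E' : Type*} [AddCommGroup E'] [Module ℝ E'] {P : Set E} (hP : IsPolyhedral P)
    (f : E' →ₗ[ℝ] E) : IsPolyhedral (f ⁻¹' P) := by
  classical
  obtain ⟨T, rfl⟩ := hP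
  refine ⟨T.image fun p => (p.1.comp f, p.2), ?_⟩
  ext x
  simp only [mem_preimage, mem_ofPred_eq, Finset.forall_mem_image, LinearMap.comp_apply]

theorem convex {P : Set E} (hP : IsPolyhedral P) : Convex ℝ P := by
  obtain ⟨T, rfl⟩ := hP
  simp only [ofPred_forall]
  exact convex_iInter fun p => convex_iInter fun _ => convex_halfSpace_le p.1.isLinear _

theorem isClosed {E : Type*} [NormedAddCommGroup E] [NormedSpace ℝ E] [FiniteDimensional ℝ E]
    {P : Set E} (hP : IsPolyhedral P) : IsClosed P := by
  obtain ⟨T, rfl⟩ := hP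
  simp only [ofPred_forall]
  exact isClosed_iInter fun p => isClosed_iInter fun _ =>
    isClosed_le p.1.continuous_of_finiteDimensional continuous_const

/-- A linear functional that is maximized on the intersection of a polyhedron and a subspace can
be corrected by a functional vanishing on the subspace to one maximized on the polyhedron. -/
theorem exists_dual {P : Set E} (hP : IsPolyhedral P) (W : Submodule ℝ E) (φ : Module.Dual ℝ E)
    {x₀ : E} (hx₀ : x₀ ∈ P) (hx₀W : x₀ ∈ W) (hmax : ∀ y ∈ P, y ∈ W → φ y ≤ φ x₀) :
    ∃ ψ : Module.Dual ℝ E, (∀ w ∈ W, ψ w = 0) ∧ ∀ y ∈ P, φ y - ψ y ≤ φ x₀ := by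
  classical
  obtain ⟨T, rfl⟩ := hP
  simp only [mem_ofPred_eq] at hx₀ hmax
  obtain ⟨c, hc, hφ⟩ := farkas (T.filter fun p => p.1 x₀ = p.2)
    (fun p => p.1.comp W.subtype) (φ.comp W.subtype) (by
      intro w hw
      -- A short step along `w` stays in the polyhedron: active constraints do not increase,
      -- inactive ones have slack.
      have hev : ∀ᶠ t : ℝ in 𝓝[>] 0, ∀ p ∈ T, p.1 (x₀ + t • (w : E)) ≤ p.2 := by
        rw [Filter.eventually_all_finset]
        intro p hp
        by_cases hact : p.1 x₀ = p.2
        · have h1 := hw p (Finset.mem_filter.2 ⟨hp, hact⟩)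
          simp only [LinearMap.comp_apply, Submodule.subtype_apply] at h1
          filter_upwards [self_mem_nhdsWithin] with t ht
          rw [map_add, map_smul, smul_eq_mul, hact]
          nlinarith [mul_nonneg (le_of_lt (mem_Ioi.1 ht)) (neg_nonneg.2 h1)]
        · have hlt : p.1 x₀ < p.2 := lt_of_le_of_ne (hx₀ p hp) hact
          have hcont : Continuous fun t : ℝ => p.1 x₀ + t * p.1 (w : E) := by fun_prop
          have h2 := (hcont.tendsto 0).eventually_lt_const (by simpa using hlt : _ < p.2)
          filter_upwards [nhdsWithin_le_nhds h2] with t ht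
          rw [map_add, map_smul, smul_eq_mul]
          exact ht.le
      obtain ⟨t, hT, ht⟩ := (hev.and self_mem_nhdsWithin).exists
      have h3 := hmax _ hT (W.add_mem hx₀W (W.smul_mem t w.2))
      rw [map_add, map_smul, smul_eq_mul] at h3
      simp only [LinearMap.comp_apply, Submodule.subtype_apply]
      by_contra hcon
      have := mul_pos (mem_Ioi.1 ht) (not_le.1 hcon)
      linarith)
  -- On `W` the functional `φ` is a nonnegative combination of the active constraints. The
  -- combination itself attains its maximum over the whole polyhedron at `x₀`, so `ψ` is the
  -- difference of the two.
  refine ⟨φ - ∑ p ∈ T.filter fun p => p.1 x₀ = p.2, c p • p.1, fun w hw => ?_, fun y hy => ?_⟩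
  · have := LinearMap.congr_fun hφ ⟨w, hw⟩
    simp only [LinearMap.comp_apply, Submodule.subtype_apply, LinearMap.sum_apply,
      LinearMap.smul_apply] at this
    simp only [LinearMap.sub_apply, LinearMap.sum_apply, LinearMap.smul_apply, this, sub_self]
  · have h0 := LinearMap.congr_fun hφ ⟨x₀, hx₀W⟩
    simp only [LinearMap.comp_apply, Submodule.subtype_apply, LinearMap.sum_apply,
      LinearMap.smul_apply] at h0
    simp only [LinearMap.sub_apply, LinearMap.sum_apply, LinearMap.smul_apply, sub_sub_cancel, h0]
    refine Finset.sum_le_sum fun p hp => ?_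
    obtain ⟨hpT, hact⟩ := Finset.mem_filter.1 hp
    rw [hact]
    exact mul_le_mul_of_nonneg_left (hy p hpT) (hc p)

end IsPolyhedral

/-! ### Lagrange multipliers under a partial Slater condition. -/

/-- Existence of Lagrange multipliers for the constraint `B x ∈ Z` in a convex program over the
intersection of a polyhedron and a convex set, under Slater's condition for the latter. -/
theorem exists_multiplier {E H : Type*} [NormedAddCommGroup E] [NormedSpace ℝ E]
    [NormedAddCommGroup H] [InnerProductSpace ℝ H] [FiniteDimensional ℝ H]
    {F : E → ℝ} (hF : ConvexOn ℝ Set.univ F) (hFc : Continuous F) {P Q : Set E}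
    (hP : IsPolyhedral P) (hQ : Convex ℝ Q) (B : E →ₗ[ℝ] H) (Z : Submodule ℝ H) {x₀ x₁ : E}
    (hx₀P : x₀ ∈ P) (hx₀Q : x₀ ∈ Q) (hx₀Z : B x₀ ∈ Z)
    (hx₁P : x₁ ∈ P) (hx₁Q : x₁ ∈ interior Q) (hx₁Z : B x₁ ∈ Z)
    (hmin : ∀ x ∈ P, x ∈ Q → B x ∈ Z → F x₀ ≤ F x) :
    ∃ u ∈ Zᗮ, ∀ x ∈ P, x ∈ Q → F x₀ ≤ F x + inner ℝ u (B x) := by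
  set W : Submodule ℝ E := Z.comap B
  have hS₁ : Convex ℝ {p : E × ℝ | p.1 ∈ interior Q ∧ F p.1 < p.2} := by
    have := (hF.subset (subset_univ (interior Q)) hQ.interior).convex_strict_epigraph
    exact this
  have hS₁o : IsOpen {p : E × ℝ | p.1 ∈ interior Q ∧ F p.1 < p.2} :=
    (isOpen_interior.preimage continuous_fst).inter
      (isOpen_lt (hFc.comp continuous_fst) continuous_snd)
  have hS₂ : Convex ℝ ((P ∩ W) ×ˢ Iic (F x₀)) :=
    (hP.convex.inter W.convex).prod (convex_Iic _)
  -- The strict epigraph of `F` over the interior of `Q` is separated from `(P ∩ W) × (-∞, F x₀]`; a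
  -- common point would beat the minimum.
  obtain ⟨f, c, hf₁, hf₂⟩ := geometric_hahn_banach_open hS₁ hS₁o hS₂ (by
    rw [Set.disjoint_left]
    rintro ⟨x, t⟩ ⟨hx, hxt⟩ ⟨⟨hxP, hxW⟩, ht⟩
    have := hmin x hxP (interior_subset hx) hxW
    simp only [mem_Iic] at ht hxt
    linarith)
  have hf : ∀ x t, f (x, t) = f (x, 0) + t * f (0, 1) := by
    intro x t
    have : (x, t) = (x, (0 : ℝ)) + t • ((0 : E), (1 : ℝ)) := by simp
    rw [this, map_add, map_smul, smul_eq_mul]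
  set β := f (0, 1)
  -- The Slater point lies below both sets being separated, so the separating hyperplane cannot be
  -- vertical.
  have hβ : β < 0 := by
    have h1 := hf₁ (x₁, F x₁ + 1) ⟨hx₁Q, by simp⟩
    have h2 := hf₂ (x₁, F x₀) ⟨⟨hx₁P, hx₁Z⟩, by simp⟩
    have h3 := hmin x₁ hx₁P (interior_subset hx₁Q) hx₁Z
    rw [hf] at h1 h2
    nlinarith
  have hle : ∀ x ∈ Q, f (x, 0) + F x * β ≤ c := by
    have hint : ∀ x ∈ interior Q, f (x, 0) + F x * β ≤ c := by
      intro x hx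
      have hcont : Continuous fun t : ℝ => f (x, 0) + t * β := by fun_prop
      refine le_of_tendsto (x := 𝓝[>] (F x))
        ((hcont.tendsto (F x)).mono_left nhdsWithin_le_nhds) ?_
      filter_upwards [self_mem_nhdsWithin] with t ht
      rw [← hf]
      exact (hf₁ (x, t) ⟨hx, ht⟩).le
    intro x hx
    have hcont : Continuous fun x : E => f (x, 0) + F x * β := by fun_prop
    have hcl : x ∈ closure (interior Q) := by
      rw [hQ.closure_interior_eq_closure_of_nonempty_interior ⟨x₁, hx₁Q⟩]
      exact subset_closure hx
    exact closure_minimal hint (isClosed_le hcont continuous_const) hcl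
  let φ : Module.Dual ℝ E := (-β)⁻¹ • (f.toLinearMap.comp (LinearMap.inl ℝ E ℝ))
  have hφ : ∀ x, φ x * (-β) = f (x, 0) := by
    intro x
    change (-β)⁻¹ * f (x, 0) * (-β) = f (x, 0)
    have := hβ.ne
    field_simp
  have hφF : ∀ x ∈ Q, ∀ y ∈ P, y ∈ W → φ x - F x ≤ φ y - F x₀ := by
    intro x hx y hy hyW
    have h1 := hle x hx
    have h2 := hf₂ (y, F x₀) ⟨⟨hy, hyW⟩, by simp⟩
    rw [hf, ← hφ] at h2
    rw [← hφ] at h1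
    nlinarith
  -- Separation only yields `y` in `P ∩ W`. Polyhedrality frees `y` from `W` at the price of a
  -- functional `ψ` that vanishes on `W`.
  obtain ⟨ψ, hψ, hψP⟩ := hP.exists_dual W (-φ) hx₀P hx₀Z (fun y hy hyW => by
    have := hφF x₀ hx₀Q y hy hyW
    simp only [LinearMap.neg_apply]
    linarith)
  -- The kernel of `A` is `W`, so `ψ` factors through `A` and is represented by a vector of `Zᗮ`.
  let A : E →ₗ[ℝ] H := (Zᗮ.starProjection : H →ₗ[ℝ] H).comp B
  have hA : ψ ∈ LinearMap.range A.dualMap := by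
    rw [LinearMap.range_dualMap_eq_dualAnnihilator_ker, Submodule.mem_dualAnnihilator]
    intro w hw
    apply hψ
    have : Zᗮ.starProjection (B w) = 0 := hw
    rw [Submodule.starProjection_apply_eq_zero_iff, Submodule.orthogonal_orthogonal] at this
    exact this
  obtain ⟨g, rfl⟩ := hA
  let m := (InnerProductSpace.toDual ℝ H).symm (LinearMap.toContinuousLinearMap g)
  have hm : ∀ y, inner ℝ m y = g y := fun y => by
    simp [m]
  refine ⟨Zᗮ.starProjection m, Submodule.starProjection_apply_mem _ _, ?_⟩
  intro x hxP hxQ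
  have h1 := hψP x hxP
  have h2 := hφF x hxQ x₀ hx₀P hx₀Z
  simp only [LinearMap.neg_apply, LinearMap.dualMap_apply, A, LinearMap.comp_apply] at h1
  rw [Submodule.inner_starProjection_left_eq_right, hm]
  simp only [ContinuousLinearMap.coe_coe] at h1
  linarith

/-! ### Convergence and attainment for convex functions in finite dimension. -/

theorem ConvexOn.continuous_of_univ {E : Type*} [NormedAddCommGroup E] [NormedSpace ℝ E]
    [FiniteDimensional ℝ E] {f : E → ℝ} (hf : ConvexOn ℝ Set.univ f) : Continuous f :=
  continuousOn_univ.1 (hf.continuousOn isOpen_univ)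

/-- If a convex function is nonpositive at a single point of a closed convex set, every sequence
in the set along which the function becomes asymptotically nonpositive converges to that point. -/
theorem tendsto_of_asymptotically_nonpos {E : Type*} [NormedAddCommGroup E] [NormedSpace ℝ E]
    [FiniteDimensional ℝ E] {D : Set E} (hD : Convex ℝ D) (hDc : IsClosed D) {h : E → ℝ}
    (hh : ConvexOn ℝ Set.univ h) {a : E} (haD : a ∈ D) (ha : h a ≤ 0)
    (huniq : ∀ y ∈ D, h y ≤ 0 → y = a) {x : ℕ → E} (hx : ∀ n, x n ∈ D)
    (hlim : ∀ ε > 0, ∀ᶠ n in atTop, h (x n) ≤ ε) : Tendsto x atTop (𝓝 a) := by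
  have := FiniteDimensional.proper ℝ E
  have hcont := hh.continuous_of_univ
  by_contra hcon
  rw [Metric.tendsto_nhds] at hcon
  push Not at hcon
  obtain ⟨ε, hε, hfreq⟩ := hcon
  obtain ⟨φ, hφ, hφε⟩ := extraction_of_frequently_atTop hfreq
  let t : ℕ → ℝ := fun n => ε / ‖x (φ n) - a‖
  have hpos : ∀ n, 0 < ‖x (φ n) - a‖ := fun n => by
    have := hφε n
    rw [dist_eq_norm] at this
    exact lt_of_lt_of_le hε this
  have ht0 : ∀ n, 0 ≤ t n := fun n => div_nonneg hε.le (norm_nonneg _)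
  have ht1 : ∀ n, t n ≤ 1 := fun n => by
    have := hφε n
    rw [dist_eq_norm] at this
    exact (div_le_one (hpos n)).2 this
  let y : ℕ → E := fun n => (1 - t n) • a + t n • x (φ n)
  -- Far points are pulled back along segments to the sphere of radius `ε` about `a`. Convexity
  -- keeps `h` asymptotically nonpositive there, and compactness gives a second point with `h ≤ 0`.
  have hyD : ∀ n, y n ∈ D := fun n =>
    hD haD (hx _) (sub_nonneg.2 (ht1 n)) (ht0 n) (by ring)
  have hysph : ∀ n, y n ∈ Metric.sphere a ε := fun n => by
    have : y n - a = t n • (x (φ n) - a) := by simp only [y]; module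
    rw [mem_sphere_iff_norm, this, norm_smul, Real.norm_of_nonneg (ht0 n)]
    exact div_mul_cancel₀ _ (hpos n).ne'
  obtain ⟨b, hb, ψ, hψ, hψb⟩ := (isCompact_sphere a ε).tendsto_subseq hysph
  have hbD : b ∈ D := hDc.mem_of_tendsto hψb (.of_forall fun n => hyD _)
  have hb0 : h b ≤ 0 := by
    refine le_of_forall_pos_le_add fun δ hδ => ?_
    refine le_of_tendsto ((hcont.tendsto b).comp hψb) ?_
    filter_upwards [(hφ.comp hψ).tendsto_atTop.eventually (hlim δ hδ)] with n hn
    simp only [Function.comp_apply] at hn ⊢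
    have h1 := hh.2 (mem_univ a) (mem_univ (x (φ (ψ n)))) (sub_nonneg.2 (ht1 (ψ n)))
      (ht0 (ψ n)) (by ring)
    simp only [smul_eq_mul] at h1
    have h2 := mul_nonneg (sub_nonneg.2 (ht1 (ψ n))) (neg_nonneg.2 ha)
    have h3 := mul_le_mul_of_nonneg_left hn (ht0 (ψ n))
    have h4 := mul_le_mul_of_nonneg_right (ht1 (ψ n)) hδ.le
    linarith
  have := huniq b hbD hb0
  rw [this, mem_sphere_iff_norm, sub_self, norm_zero] at hb
  exact hε.ne hb

/-- A convex function attains its minimum on a closed convex set if it increases somewhere along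
every ray of the set from a given point. -/
theorem exists_isMinOn_of_rays {E : Type*} [NormedAddCommGroup E] [NormedSpace ℝ E]
    [FiniteDimensional ℝ E] {D : Set E} (hD : Convex ℝ D) (hDc : IsClosed D) {f : E → ℝ}
    (hf : ConvexOn ℝ Set.univ f) {a : E} (haD : a ∈ D)
    (hray : ∀ d, (∀ r : ℝ, 0 ≤ r → a + r • d ∈ D ∧ f (a + r • d) ≤ f a) → d = 0) :
    ∃ x ∈ D, IsMinOn f D x := by
  have := FiniteDimensional.proper ℝ E
  have hcont := hf.continuous_of_univ
  set S : Set E := D ∩ {x | f x ≤ f a}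
  have hSconv : Convex ℝ S := by
    have := hf.convex_le (f a)
    simp only [mem_univ, true_and] at this
    exact hD.inter this
  have hSc : IsClosed S := hDc.inter (isClosed_le hcont continuous_const)
  have haS : a ∈ S := ⟨haD, le_refl (f a)⟩
  have hbdd : Bornology.IsBounded S := by
    by_contra hunb
    have hfar : ∀ n : ℕ, ∃ y ∈ S, (n : ℝ) < ‖y - a‖ := by
      intro n
      by_contra hcon
      push Not at hcon
      exact hunb (Metric.isBounded_closedBall.subset fun y hy =>
        mem_closedBall_iff_norm.2 (hcon y hy))
    choose y hyS hy using hfar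
    have hpos : ∀ n, 0 < ‖y n - a‖ := fun n => (Nat.cast_nonneg n).trans_lt (hy n)
    have hsph : ∀ n, ‖y n - a‖⁻¹ • (y n - a) ∈ Metric.sphere (0 : E) 1 := fun n => by
      rw [mem_sphere_zero_iff_norm, norm_smul, norm_inv, norm_norm, inv_mul_cancel₀ (hpos n).ne']
    obtain ⟨d, hd, φ, hφ, hφd⟩ := (isCompact_sphere (0 : E) 1).tendsto_subseq hsph
    -- A limit of normalized directions to far points of the sublevel set spans a ray inside this
    -- closed convex set.
    have : d = 0 := hray d fun r hr => by
      have hmem : a + r • d ∈ S := by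
        refine hSc.mem_of_tendsto (tendsto_const_nhds.add (hφd.const_smul r)) ?_
        filter_upwards [eventually_ge_atTop ⌈r⌉₊] with n hn
        have h1 : r ≤ ‖y (φ n) - a‖ := by
          have h2 : (⌈r⌉₊ : ℝ) ≤ φ n := by exact_mod_cast hn.trans (hφ.id_le n)
          exact (Nat.le_ceil r).trans (h2.trans (hy _).le)
        have h3 : r * ‖y (φ n) - a‖⁻¹ ≤ 1 := by
          rw [← div_eq_mul_inv]; exact (div_le_one (hpos _)).2 h1
        have h4 : 0 ≤ r * ‖y (φ n) - a‖⁻¹ := mul_nonneg hr (inv_nonneg.2 (norm_nonneg _))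
        have h5 := hSconv haS (hyS (φ n)) (sub_nonneg.2 h3) h4 (by ring)
        convert h5 using 1
        simp only [Function.comp_apply]
        module
      exact hmem
    rw [this, mem_sphere_zero_iff_norm, norm_zero] at hd
    exact zero_ne_one hd
  obtain ⟨x, hx, hmin⟩ := (Metric.isCompact_of_isClosed_isBounded hSc hbdd).exists_isMinOn
    ⟨a, haS⟩ hcont.continuousOn
  refine ⟨x, hx.1, fun y hy => ?_⟩
  by_cases hya : f y ≤ f a
  · exact hmin ⟨hy, hya⟩
  · exact hx.2.trans (not_le.1 hya).le

/-! ### Abstract ADMM and its convergence. -/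

section ADMM

variable {E H : Type*} [NormedAddCommGroup E] [NormedSpace ℝ E]
  [NormedAddCommGroup H] [InnerProductSpace ℝ H]

/-- The augmented Lagrangian for the constraint `B x = z`. -/
noncomputable def augLagrangian (F : E → ℝ) (B : E →ₗ[ℝ] H) (κ : ℝ) (u z : H) (x : E) : ℝ :=
  F x + inner ℝ u (B x) + κ / 2 * ‖B x - z‖ ^ 2

/-- First-order optimality condition of a minimizer of the augmented Lagrangian. -/
theorem variational_of_isMinOn_augLagrangian {D : Set E} (hD : Convex ℝ D) {F : E → ℝ}
    (hF : ConvexOn ℝ Set.univ F) (B : E →ₗ[ℝ] H) {κ : ℝ} {u z : H} {x : E} (hx : x ∈ D)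
    (hmin : IsMinOn (augLagrangian F B κ u z) D x) {y : E} (hy : y ∈ D) :
    0 ≤ F y - F x + inner ℝ (u + κ • (B x - z)) (B y - B x) := by
  -- Comparing `x` with the point at parameter `t` towards `y` and dividing by `t` leaves this
  -- expression; its last term disappears as `t` tends to zero.
  have hcont : Continuous fun t : ℝ =>
      F y - F x + inner ℝ (u + κ • (B x - z)) (B y - B x) + t * (κ / 2 * ‖B y - B x‖ ^ 2) := by
    fun_prop
  have hlim := (hcont.tendsto 0).mono_left (nhdsWithin_le_nhds (s := Ioi 0))
  rw [zero_mul, add_zero] at hlim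
  refine ge_of_tendsto hlim ?_
  filter_upwards [Ioc_mem_nhdsGT zero_lt_one] with t ht
  have h1 := hmin (hD hx hy (sub_nonneg.2 ht.2) ht.1.le (by ring))
  have h2 := hF.2 (mem_univ x) (mem_univ y) (sub_nonneg.2 ht.2) ht.1.le (by ring)
  simp only [mem_ofPred_eq, augLagrangian] at h1
  simp only [smul_eq_mul] at h2
  have e1 : B ((1 - t) • x + t • y) = B x + t • (B y - B x) := by
    rw [map_add, map_smul, map_smul]; module
  have e2 : B x + t • (B y - B x) - z = (B x - z) + t • (B y - B x) := by abel
  rw [e1, e2, norm_add_sq_real, inner_add_right, inner_smul_right, inner_smul_right, norm_smul,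
    mul_pow, Real.norm_of_nonneg ht.1.le] at h1
  rw [inner_add_left, inner_smul_left]
  simp only [conj_trivial]
  have h3 : 0 ≤ t * (F y - F x + (inner ℝ u (B y - B x) + κ * inner ℝ (B x - z) (B y - B x))
      + t * (κ / 2 * ‖B y - B x‖ ^ 2)) := by
    nlinarith
  exact nonneg_of_mul_nonneg_right h3 ht.1

variable {D : Set E} {F : E → ℝ} {B : E →ₗ[ℝ] H} {Z : Submodule ℝ H} {κ : ℝ}
  {x : ℕ → E} {z u : ℕ → H}

/-- `x`, `z`, `u` are iterates of the alternating direction method of multipliers for minimizing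
`F` over the points of `D` that `B` maps to `Z`. -/
structure IsADMM (D : Set E) (F : E → ℝ) (B : E →ₗ[ℝ] H) (Z : Submodule ℝ H) (κ : ℝ)
    (x : ℕ → E) (z u : ℕ → H) : Prop where
  mem : ∀ n, x (n + 1) ∈ D
  isMinOn : ∀ n, IsMinOn (augLagrangian F B κ (u n) (z n)) D (x (n + 1))
  z_mem : ∀ n, z n ∈ Z
  -- With `z_mem`, this makes `z (n + 1)` the orthogonal projection of `B (x (n + 1))` onto `Z`. The
  -- multiplier is orthogonal to `Z` and drops out of the minimization over `Z`.
  residual_mem : ∀ n, B (x (n + 1)) - z (n + 1) ∈ Zᗮ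
  u_zero : u 0 ∈ Zᗮ
  u_succ : ∀ n, u (n + 1) = u n + κ • (B (x (n + 1)) - z (n + 1))

namespace IsADMM

theorem u_mem (h : IsADMM D F B Z κ x z u) (n : ℕ) : u n ∈ Zᗮ := by
  induction n with
  | zero => exact h.u_zero
  | succ n ih => rw [h.u_succ]; exact add_mem ih (Submodule.smul_mem _ _ (h.residual_mem n))

/-- The gradient of the augmented term involves the old `z n`; rewriting it with the new multiplier
leaves the correction `κ • (z (n + 1) - z n)`. -/
theorem variational (h : IsADMM D F B Z κ x z u) (hD : Convex ℝ D)
    (hF : ConvexOn ℝ Set.univ F) (n : ℕ) {y : E} (hy : y ∈ D) :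
    0 ≤ F y - F (x (n + 1))
      + inner ℝ (u (n + 1) + κ • (z (n + 1) - z n)) (B y - B (x (n + 1))) := by
  have := variational_of_isMinOn_augLagrangian hD hF B (h.mem n) (h.isMinOn n) hy
  convert this using 3
  rw [h.u_succ]
  module

/-- In the variational inequality, `B y - B (x (n + 1))` splits into a part in `Z` and the residual
in `Zᗮ`. The multiplier pairs only with the latter, the increment of `z` only with the former. -/
theorem objective_le (h : IsADMM D F B Z κ x z u) (hD : Convex ℝ D)
    (hF : ConvexOn ℝ Set.univ F) (n : ℕ) {y : E} (hy : y ∈ D) (hyZ : B y ∈ Z) :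
    F (x (n + 1)) ≤ F y - inner ℝ (u (n + 1)) (B (x (n + 1)) - z (n + 1))
      + κ * inner ℝ (z (n + 1) - z n) (B y - z (n + 1)) := by
  have h1 := h.variational hD hF n hy
  have h2 : B y - B (x (n + 1)) = (B y - z (n + 1)) - (B (x (n + 1)) - z (n + 1)) := by abel
  have h3 : inner ℝ (u (n + 1)) (B y - z (n + 1)) = (0 : ℝ) :=
    Submodule.inner_left_of_mem_orthogonal (sub_mem hyZ (h.z_mem _)) (h.u_mem _)
  have h4 : inner ℝ (z (n + 1) - z n) (B (x (n + 1)) - z (n + 1)) = (0 : ℝ) :=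
    Submodule.inner_right_of_mem_orthogonal (sub_mem (h.z_mem _) (h.z_mem _)) (h.residual_mem n)
  rw [h2, inner_sub_right, inner_add_left, inner_add_left, inner_smul_left, inner_smul_left, h3,
    h4] at h1
  simp only [conj_trivial] at h1
  linarith

/-- Fejér monotonicity with respect to a saddle point. -/
theorem fejer (h : IsADMM D F B Z κ x z u) (hD : Convex ℝ D) (hF : ConvexOn ℝ Set.univ F)
    (hκ : 0 < κ) {y : E} (hy : y ∈ D) (hyZ : B y ∈ Z) {v : H} (hv : v ∈ Zᗮ)
    (hsaddle : ∀ w ∈ D, F y ≤ F w + inner ℝ v (B w)) (n : ℕ) :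
    ‖u (n + 1) - v‖ ^ 2 + κ ^ 2 * ‖z (n + 1) - B y‖ ^ 2
      + (‖u (n + 1) - u n‖ ^ 2 + κ ^ 2 * ‖z (n + 1) - z n‖ ^ 2)
      ≤ ‖u n - v‖ ^ 2 + κ ^ 2 * ‖z n - B y‖ ^ 2 := by
  have h1 := h.objective_le hD hF n hy hyZ
  have h2 := hsaddle _ (h.mem n)
  have h3 : inner ℝ v (z (n + 1)) = (0 : ℝ) :=
    Submodule.inner_left_of_mem_orthogonal (h.z_mem _) hv
  set r := B (x (n + 1)) - z (n + 1) with hr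
  have h4 : inner ℝ v (B (x (n + 1))) = inner ℝ v r := by rw [hr, inner_sub_right, h3, sub_zero]
  have h5 : u (n + 1) - u n = κ • r := by rw [h.u_succ, hr]; abel
  have h6 : u n - v = (u (n + 1) - v) - κ • r := by rw [← h5]; abel
  have h7 : z n - B y = (z (n + 1) - B y) - (z (n + 1) - z n) := by abel
  have h8 : inner ℝ (z (n + 1) - z n) (B y - z (n + 1))
      = -inner ℝ (z (n + 1) - B y) (z (n + 1) - z n) := by
    rw [real_inner_comm, ← inner_neg_left, neg_sub]
  rw [h6, h7, norm_sub_sq_real (u (n + 1) - v), norm_sub_sq_real (z (n + 1) - B y), h5,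
    inner_smul_right, inner_sub_left]
  rw [h4] at h2
  rw [h8] at h1
  -- The bound on the objective plus the saddle inequality at `x (n + 1)`; the objective values
  -- cancel, and expanding the squares turns this into the claim.
  have h9 : 0 ≤ κ * (inner ℝ v r - inner ℝ (u (n + 1)) r
      - κ * inner ℝ (z (n + 1) - B y) (z (n + 1) - z n)) :=
    mul_nonneg hκ.le (by linarith)
  linarith

/-- Convergence of the alternating direction method of multipliers to the solution of a problem
with a unique solution and a saddle point. -/
theorem tendsto [FiniteDimensional ℝ E] [FiniteDimensional ℝ H] (h : IsADMM D F B Z κ x z u)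
    (hD : Convex ℝ D) (hDc : IsClosed D) (hF : ConvexOn ℝ Set.univ F)
    (hκ : 0 < κ) {y : E} (hy : y ∈ D) (hyZ : B y ∈ Z)
    (huniq : ∀ w ∈ D, B w ∈ Z → F w ≤ F y → w = y)
    (hsaddle : ∃ v ∈ Zᗮ, ∀ w ∈ D, F y ≤ F w + inner ℝ v (B w)) :
    Tendsto x atTop (𝓝 y) ∧ ∃ v, Tendsto u atTop (𝓝 v) := by
  have := FiniteDimensional.proper ℝ H
  have hFc := hF.continuous_of_univ
  have hBc : Continuous B := B.continuous_of_finiteDimensional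
  obtain ⟨v, hv, hvs⟩ := hsaddle
  -- The multiplier remains a parameter of the Lyapunov function, which is used for the given `v`
  -- and later for a cluster point of `u`.
  set V : H → ℕ → ℝ := fun v n => ‖u n - v‖ ^ 2 + κ ^ 2 * ‖z n - B y‖ ^ 2 with hV
  have hV0 : ∀ v n, 0 ≤ V v n := fun v n => by positivity
  have hanti : ∀ v ∈ Zᗮ, (∀ w ∈ D, F y ≤ F w + inner ℝ v (B w)) → Antitone (V v) :=
    fun v hv hvs => antitone_nat_of_succ_le fun n => by
      have := h.fejer hD hF hκ hy hyZ hv hvs n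
      have h0 : 0 ≤ ‖u (n + 1) - u n‖ ^ 2 + κ ^ 2 * ‖z (n + 1) - z n‖ ^ 2 := by positivity
      simp only [hV]
      linarith
  have hVlim : Tendsto (V v) atTop (𝓝 (⨅ n, V v n)) :=
    tendsto_atTop_ciInf (hanti v hv hvs) ⟨0, by rintro _ ⟨n, rfl⟩; exact hV0 v n⟩
  have hdiff : Tendsto (fun n => V v n - V v (n + 1)) atTop (𝓝 0) := by
    have := hVlim.sub ((tendsto_add_atTop_iff_nat 1).2 hVlim)
    rwa [sub_self] at this
  have hdec : ∀ n, ‖u (n + 1) - u n‖ ^ 2 + κ ^ 2 * ‖z (n + 1) - z n‖ ^ 2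
      ≤ V v n - V v (n + 1) := fun n => by
    have := h.fejer hD hF hκ hy hyZ hv hvs n
    simp only [hV]
    linarith
  have hsq : ∀ {f : ℕ → H}, Tendsto (fun n => ‖f n‖ ^ 2) atTop (𝓝 0) → Tendsto f atTop (𝓝 0) := by
    intro f hf
    rw [tendsto_zero_iff_norm_tendsto_zero]
    have := hf.sqrt
    simpa [Real.sqrt_sq] using this
  have hdu : Tendsto (fun n => u (n + 1) - u n) atTop (𝓝 0) := by
    refine hsq (squeeze_zero (fun n => by positivity) (fun n => ?_) hdiff)
    have h0 : 0 ≤ κ ^ 2 * ‖z (n + 1) - z n‖ ^ 2 := by positivity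
    linarith [hdec n]
  have hdz : Tendsto (fun n => κ • (z (n + 1) - z n)) atTop (𝓝 0) := by
    refine hsq (squeeze_zero (fun n => by positivity) (fun n => ?_) hdiff)
    have h0 : 0 ≤ ‖u (n + 1) - u n‖ ^ 2 := by positivity
    rw [norm_smul, mul_pow, Real.norm_of_nonneg hκ.le]
    linarith [hdec n]
  have hr : Tendsto (fun n => B (x (n + 1)) - z (n + 1)) atTop (𝓝 0) := by
    have := hdu.const_smul κ⁻¹
    rw [smul_zero] at this
    refine this.congr fun n => ?_
    rw [h.u_succ, add_sub_cancel_left, smul_smul, inv_mul_cancel₀ hκ.ne', one_smul]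
  set M := V v 0 with hM
  have hVM : ∀ n, V v n ≤ M := fun n => hanti v hv hvs (Nat.zero_le n)
  have hub : ∀ n, ‖u n - v‖ ≤ √M := fun n => by
    refine Real.le_sqrt_of_sq_le ((?_ : _ ≤ V v n).trans (hVM n))
    simp only [hV]
    have h0 : 0 ≤ κ ^ 2 * ‖z n - B y‖ ^ 2 := by positivity
    linarith
  have hzb : ∀ n, κ * ‖z n - B y‖ ≤ √M := fun n => by
    refine Real.le_sqrt_of_sq_le ((?_ : _ ≤ V v n).trans (hVM n))
    simp only [hV]
    have h0 : 0 ≤ ‖u n - v‖ ^ 2 := by positivity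
    rw [mul_pow]
    linarith
  have hub' : ∀ n, ‖u n‖ ≤ √M + ‖v‖ := fun n => by
    have := norm_add_le (u n - v) v
    rw [sub_add_cancel] at this
    linarith [hub n]
  -- convergence of the primal iterates
  have hbound : ∀ n, F (x (n + 1)) - F y ≤ (√M + ‖v‖) * ‖B (x (n + 1)) - z (n + 1)‖
      + ‖κ • (z (n + 1) - z n)‖ * (κ⁻¹ * √M) := fun n => by
    have h1 := h.objective_le hD hF n hy hyZ
    have h2 := abs_real_inner_le_norm (u (n + 1)) (B (x (n + 1)) - z (n + 1))
    have h3 := abs_real_inner_le_norm (κ • (z (n + 1) - z n)) (B y - z (n + 1))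
    rw [inner_smul_left] at h3
    simp only [conj_trivial] at h3
    have h4 : ‖B y - z (n + 1)‖ ≤ κ⁻¹ * √M := by
      rw [← norm_neg, neg_sub, inv_mul_eq_div, le_div_iff₀' hκ]
      exact hzb _
    have h5 := mul_le_mul_of_nonneg_right (hub' (n + 1))
      (norm_nonneg (B (x (n + 1)) - z (n + 1)))
    have h6 := mul_le_mul_of_nonneg_left h4 (norm_nonneg (κ • (z (n + 1) - z n)))
    have h7 := neg_le_of_abs_le h2
    have h8 := le_of_abs_le h3
    linarith
  have hbound0 : Tendsto (fun n => (√M + ‖v‖) * ‖B (x (n + 1)) - z (n + 1)‖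
      + ‖κ • (z (n + 1) - z n)‖ * (κ⁻¹ * √M)) atTop (𝓝 0) := by
    have := (hr.norm.const_mul (√M + ‖v‖)).add (hdz.norm.mul_const (κ⁻¹ * √M))
    simpa using this
  -- The norm of `A w` measures how far `B w` is from `Z`; at the iterates `A` gives the residual.
  let A : E →ₗ[ℝ] H := (Zᗮ.starProjection : H →ₗ[ℝ] H).comp B
  have hA : ∀ w, A w = 0 ↔ B w ∈ Z := fun w => by
    change Zᗮ.starProjection (B w) = 0 ↔ _
    rw [Submodule.starProjection_apply_eq_zero_iff, Submodule.orthogonal_orthogonal]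
  have hAx : ∀ n, A (x (n + 1)) = B (x (n + 1)) - z (n + 1) := fun n => by
    change Zᗮ.starProjection (B (x (n + 1))) = _
    have h1 := Submodule.starProjection_eq_self_iff.2 (h.residual_mem n)
    have h2 : Zᗮ.starProjection (z (n + 1)) = 0 := by
      rw [Submodule.starProjection_apply_eq_zero_iff, Submodule.orthogonal_orthogonal]
      exact h.z_mem _
    rw [map_sub, h2, sub_zero] at h1
    exact h1
  -- This maximum is nonpositive on `D` only at feasible points that are no worse than `y`, hence
  -- only at `y`.
  have hconv : ConvexOn ℝ Set.univ ((fun w => F w - F y) ⊔ fun w => ‖A w‖) := by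
    refine ConvexOn.sup ?_ ?_
    · exact hF.sub (concaveOn_const _ convex_univ)
    · exact (convexOn_norm convex_univ).comp_linearMap A
  have hx : Tendsto x atTop (𝓝 y) := by
    rw [← tendsto_add_atTop_iff_nat 1]
    refine tendsto_of_asymptotically_nonpos hD hDc hconv hy ?_ ?_ h.mem ?_
    · simp [(hA y).2 hyZ]
    · intro w hw hw0
      simp only [Pi.sup_apply, sup_le_iff, norm_le_zero_iff, hA, sub_nonpos] at hw0
      exact huniq w hw hw0.2 hw0.1
    · intro ε hε
      have h1 := hr.norm
      rw [norm_zero] at h1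
      filter_upwards [hbound0.eventually_lt_const hε, h1.eventually_lt_const hε] with n h2 h3
      simp only [Pi.sup_apply, sup_le_iff]
      exact ⟨(hbound n).trans h2.le, by rw [hAx]; exact h3.le⟩
  refine ⟨hx, ?_⟩
  have hBx : Tendsto (fun n => B (x (n + 1))) atTop (𝓝 (B y)) :=
    (hBc.tendsto y).comp ((tendsto_add_atTop_iff_nat 1).2 hx)
  have hz : Tendsto (fun n => z (n + 1)) atTop (𝓝 (B y)) := by
    have := hBx.sub hr
    simpa using this
  -- a cluster point of the multipliers is a multiplier of the problem
  obtain ⟨ul, -, φ, hφ, hul⟩ := tendsto_subseq_of_bounded (x := fun n => u (n + 1))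
    (Metric.isBounded_closedBall (x := (0 : H)) (r := √M + ‖v‖))
    fun n => mem_closedBall_zero_iff.2 (hub' _)
  have hulZ : ul ∈ Zᗮ :=
    Z.isClosed_orthogonal.mem_of_tendsto hul (.of_forall fun n => h.u_mem _)
  have huls : ∀ w ∈ D, F y ≤ F w + inner ℝ ul (B w) := by
    intro w hw
    have hlim : Tendsto (fun n => F w - F (x (φ n + 1))
        + inner ℝ (u (φ n + 1) + κ • (z (φ n + 1) - z (φ n))) (B w - B (x (φ n + 1)))) atTop
        (𝓝 (F w - F y + inner ℝ (ul + 0) (B w - B y))) := by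
      have hxφ := ((tendsto_add_atTop_iff_nat 1).2 hx).comp hφ.tendsto_atTop
      exact (tendsto_const_nhds.sub ((hFc.tendsto y).comp hxφ)).add
        ((hul.add (hdz.comp hφ.tendsto_atTop)).inner
          (tendsto_const_nhds.sub (hBx.comp hφ.tendsto_atTop)))
    have h1 := ge_of_tendsto' hlim fun n => h.variational hD hF (φ n) hw
    have h2 : inner ℝ ul (B y) = (0 : ℝ) := Submodule.inner_left_of_mem_orthogonal hyZ hulZ
    rw [add_zero, inner_sub_right, h2] at h1
    linarith
  refine ⟨ul, ?_⟩
  have hV1 : Tendsto (fun n => V ul (φ n + 1)) atTop (𝓝 0) := by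
    have h1 := (hul.sub (tendsto_const_nhds (x := ul))).norm.pow 2
    have h2 := ((hz.comp hφ.tendsto_atTop).sub (tendsto_const_nhds (x := B y))).norm.pow 2
    have := h1.add (h2.const_mul (κ ^ 2))
    simpa using this
  -- The function `V ul` is antitone, so its limit along a subsequence is its limit.
  have hV2 : Tendsto (V ul) atTop (𝓝 0) :=
    (tendsto_iff_tendsto_subseq_of_antitone (hanti ul hulZ huls)
      ((tendsto_add_atTop_nat 1).comp hφ.tendsto_atTop)).2 hV1
  have hV3 : Tendsto (fun n => u n - ul) atTop (𝓝 0) := by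
    refine hsq (squeeze_zero (fun n => by positivity) (fun n => ?_) hV2)
    simp only [hV]
    have h0 : 0 ≤ κ ^ 2 * ‖z n - B y‖ ^ 2 := by positivity
    linarith
  simpa using hV3.add_const ul

end IsADMM

end ADMM

namespace Microgrid

variable {N L K : ℕ} (M : Microgrid N L K)

/-! ### The constraints as polyhedral and convex sets -/

theorem phaseCurrent_add {e : M.Line} (v w : M.LineVec e) (φ : Phase) (i : Fin 2) :
    M.phaseCurrent (v + w) φ i = M.phaseCurrent v φ i + M.phaseCurrent w φ i := by
  unfold phaseCurrent; split_ifs <;> simp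

theorem phaseCurrent_smul {e : M.Line} (c : ℝ) (v : M.LineVec e) (φ : Phase) (i : Fin 2) :
    M.phaseCurrent (c • v) φ i = c * M.phaseCurrent v φ i := by
  unfold phaseCurrent; split_ifs <;> simp

theorem injection_add {S : Finset M.Line} (x y : M.Vec S) (n : Fin N) (φ : Phase) (i : Fin 2) :
    M.injection (x + y) n φ i = M.injection x n φ i + M.injection y n φ i := by
  have h : ∀ (p : Prop) [Decidable p] (a b : ℝ),
      (if p then a + b else 0) = (if p then a else 0) + if p then b else 0 := by
    intro p _ a b; split_ifs <;> simp
  simp only [injection, Pi.add_apply, phaseCurrent_add, h, Finset.sum_add_distrib]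
  ring

theorem injection_smul {S : Finset M.Line} (c : ℝ) (x : M.Vec S) (n : Fin N) (φ : Phase)
    (i : Fin 2) : M.injection (c • x) n φ i = c * M.injection x n φ i := by
  have h : ∀ (p : Prop) [Decidable p] (a : ℝ),
      (if p then c * a else 0) = c * if p then a else 0 := by
    intro p _ a; split_ifs <;> simp
  simp only [injection, Pi.smul_apply, phaseCurrent_smul, h, ← Finset.mul_sum]
  ring

theorem isLinearMap_injection {S : Finset M.Line} {T : Finset (Fin N × Phase)} (n : Fin N)
    (φ : Phase) (i : Fin 2) :
    IsLinearMap ℝ fun x : M.Vec S × M.DGVec T => M.injection x.1 n φ i :=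
  ⟨fun x y => M.injection_add x.1 y.1 n φ i, fun c x => M.injection_smul c x.1 n φ i⟩

/-- With the DG power moved to the left, load satisfaction bounds a linear functional by a constant.
-/
theorem isLinearMap_powerBalance {S : Finset M.Line} {T : Finset (Fin N × Phase)} (n : Fin N)
    (φ : Phase) (i : Fin 2) :
    IsLinearMap ℝ fun x : M.Vec S × M.DGVec T =>
      M.nomPower φ (M.injection x.1 n φ) i - M.dgPower x.2 n φ i := by
  constructor
  · intro x y
    have h : M.dgPower (x + y).2 n φ i = M.dgPower x.2 n φ i + M.dgPower y.2 n φ i := by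
      unfold dgPower; split_ifs <;> simp
    rw [h]
    fin_cases i <;> simp [nomPower, injection_add] <;> ring
  · intro c x
    have h : M.dgPower (c • x).2 n φ i = c * M.dgPower x.2 n φ i := by
      unfold dgPower; split_ifs <;> simp
    rw [h]
    fin_cases i <;> simp [nomPower, injection_smul] <;> ring

/-- The constraints other than the limits on the current magnitudes. -/
def nodalSet (S : Finset M.Line) (T : Finset (Fin N × Phase)) (A : Finset (Fin N)) :
    Set (M.Vec S × M.DGVec T) :=
  {x | (∀ n, n ∈ A → ∀ φ, (n, φ) ∈ M.demand → ∀ i,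
      M.nomPower φ (M.injection x.1 n φ) i - M.dgPower x.2 n φ i ≤ ⨅ k, M.sample n φ k i) ∧
    (∀ n, n ∈ A → ∀ φ, φ ∈ M.nodePhases n → (n, φ) ∉ M.demand → ∀ i,
      M.injection x.1 n φ i = 0) ∧
    ∀ g : T, ∀ i, M.dgMin g.1 i ≤ (x.2 g i : EReal) ∧ (x.2 g i : EReal) ≤ M.dgMax g.1 i}

/-- The limits on the current magnitudes. -/
def magnitudeSet (S : Finset M.Line) : Set (M.Vec S) :=
  {x | ∀ e : S, ∀ φ, M.magSq (x e) φ ≤ M.Imax e.1.1 ^ 2}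

theorem feasible_iff {S : Finset M.Line} {T : Finset (Fin N × Phase)} {A : Finset (Fin N)}
    {x : M.Vec S × M.DGVec T} :
    M.Feasible S T A x ↔ x ∈ M.nodalSet S T A ∧ x.1 ∈ M.magnitudeSet S := by
  constructor
  · intro h
    refine ⟨⟨fun n hn φ hφ i => ?_, h.zeroCurrent, h.dgBox⟩, h.magnitude⟩
    have := h.loadSat n hn φ hφ i
    linarith
  · rintro ⟨⟨h1, h2, h3⟩, h4⟩
    refine ⟨fun n hn φ hφ i => ?_, h4, h2, h3⟩
    have := h1 n hn φ hφ i
    linarith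

/-- Polyhedrality is what exempts these constraints, among them equalities, from strict feasibility.
-/
theorem isPolyhedral_nodalSet (S : Finset M.Line) (T : Finset (Fin N × Phase))
    (A : Finset (Fin N)) : IsPolyhedral (M.nodalSet S T A) := by
  refine .inter (.all fun n => .imp fun _ => .all fun φ => .imp fun _ => .all fun i =>
    .le (M.isLinearMap_powerBalance n φ i) _) (.inter (.all fun n => .imp fun _ => .all fun φ =>
    .imp fun _ => .imp fun _ => .all fun i => .eq (M.isLinearMap_injection n φ i) _)
    (.all fun g => .all fun i => .inter (.le_coe ?_ _) (.coe_le ?_ _)))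
  all_goals exact ⟨fun _ _ => rfl, fun _ _ => rfl⟩

theorem continuous_magSq {e : M.Line} (φ : M.linePhases e.1) :
    Continuous fun v : M.LineVec e => M.magSq v φ := by
  unfold magSq; fun_prop

theorem convexOn_magSq {e : M.Line} (φ : M.linePhases e.1) :
    ConvexOn ℝ Set.univ fun v : M.LineVec e => M.magSq v φ := by
  have h : ConvexOn ℝ Set.univ fun t : ℝ => t ^ 2 := Even.convexOn_pow even_two
  exact (h.comp_linearMap (EuclideanSpace.proj (0, φ) : M.LineVec e →L[ℝ] ℝ).toLinearMap).add
    (h.comp_linearMap (EuclideanSpace.proj (1, φ) : M.LineVec e →L[ℝ] ℝ).toLinearMap)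

theorem convex_magnitudeSet (S : Finset M.Line) : Convex ℝ (M.magnitudeSet S) := by
  simp only [magnitudeSet, ofPred_forall]
  refine convex_iInter fun e => convex_iInter fun φ => ?_
  have := ((M.convexOn_magSq φ).comp_linearMap
    (LinearMap.proj e : M.Vec S →ₗ[ℝ] M.LineVec e.1)).convex_le (M.Imax e.1.1 ^ 2)
  simpa using this

theorem isClosed_magnitudeSet (S : Finset M.Line) : IsClosed (M.magnitudeSet S) := by
  simp only [magnitudeSet, ofPred_forall]
  exact isClosed_iInter fun e => isClosed_iInter fun φ =>
    isClosed_le ((M.continuous_magSq φ).comp (continuous_apply e)) continuous_const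

theorem mem_interior_magnitudeSet {S : Finset M.Line} {x : M.Vec S}
    (hx : ∀ e φ, M.magSq (x e) φ < M.Imax e.1.1 ^ 2) : x ∈ interior (M.magnitudeSet S) := by
  have ho : IsOpen {x : M.Vec S | ∀ e φ, M.magSq (x e) φ < M.Imax e.1.1 ^ 2} := by
    simp only [ofPred_forall]
    exact isOpen_iInter_of_finite fun e => isOpen_iInter_of_finite fun φ =>
      isOpen_lt ((M.continuous_magSq φ).comp (continuous_apply e)) continuous_const
  exact mem_interior.2 ⟨_, fun y hy e φ => (hy e φ).le, ho, hx⟩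

/-- The current limits contain no ray. -/
theorem eq_zero_of_ray_magnitudeSet {S : Finset M.Line} {x d : M.Vec S}
    (h : ∀ r : ℝ, 0 ≤ r → x + r • d ∈ M.magnitudeSet S) : d = 0 := by
  have key : ∀ a b c : ℝ, (∀ r : ℝ, 0 ≤ r → (a + r * b) ^ 2 ≤ c ^ 2) → b = 0 := by
    intro a b c hr
    by_contra hb
    have hb' : 0 < |b| := abs_pos.2 hb
    -- This `r` makes `|r * b|` exceed `|a| + |c|`, so that `|a + r * b| > |c|`.
    have h1 := hr ((|a| + |c| + 1) / |b|) (by positivity)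
    rw [sq_le_sq] at h1
    have h2 : |(|a| + |c| + 1) / |b| * b| = |a| + |c| + 1 := by
      rw [abs_mul, abs_div, abs_abs, div_mul_cancel₀ _ hb'.ne', abs_of_nonneg (by positivity)]
    have h3 := abs_sub_abs_le_abs_sub ((|a| + |c| + 1) / |b| * b) (-a)
    rw [h2, abs_neg, sub_neg_eq_add, add_comm _ a] at h3
    linarith
  funext e
  ext ⟨i, φ⟩
  refine key (x e (i, φ)) _ (M.Imax e.1.1) fun r hr => ?_
  have h1 := h r hr e φ
  have h0 := sq_nonneg ((x + r • d) e (0, φ))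
  have h0' := sq_nonneg ((x + r • d) e (1, φ))
  simp only [magSq] at h1
  fin_cases i
  · exact (le_add_of_nonneg_right h0').trans h1
  · exact (le_add_of_nonneg_left h0).trans h1

theorem mem_areaFeasibleSet {ℓ : Fin L} {x : M.AreaVar ℓ} :
    x ∈ M.areaFeasibleSet ℓ ↔ x ∈ M.nodalSet (M.areaLines ℓ) (M.areaDGs ℓ) (M.areaNodes ℓ) ∧
      x.1 ∈ M.magnitudeSet (M.areaLines ℓ) :=
  M.feasible_iff

theorem convex_areaFeasibleSet (ℓ : Fin L) : Convex ℝ (M.areaFeasibleSet ℓ) := by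
  have : M.areaFeasibleSet ℓ = M.nodalSet (M.areaLines ℓ) (M.areaDGs ℓ) (M.areaNodes ℓ) ∩
      LinearMap.fst ℝ _ _ ⁻¹' M.magnitudeSet (M.areaLines ℓ) :=
    Set.ext fun x => M.mem_areaFeasibleSet
  rw [this]
  exact (M.isPolyhedral_nodalSet _ _ _).convex.inter
    ((M.convex_magnitudeSet _).linear_preimage _)

theorem isClosed_areaFeasibleSet (ℓ : Fin L) : IsClosed (M.areaFeasibleSet ℓ) := by
  have : M.areaFeasibleSet ℓ = M.nodalSet (M.areaLines ℓ) (M.areaDGs ℓ) (M.areaNodes ℓ) ∩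
      Prod.fst ⁻¹' M.magnitudeSet (M.areaLines ℓ) :=
    Set.ext fun x => M.mem_areaFeasibleSet
  rw [this]
  exact (M.isPolyhedral_nodalSet _ _ _).isClosed.inter
    ((M.isClosed_magnitudeSet _).preimage continuous_fst)

/-! ### Lines and areas -/

/-- The area at which a line starts. -/
abbrev src (e : M.Line) : Fin L := M.area e.1.1

/-- The area at which a line ends. -/
abbrev tgt (e : M.Line) : Fin L := M.area e.1.2

variable {M}

theorem mem_areaLines {ℓ : Fin L} {e : M.Line} :
    e ∈ M.areaLines ℓ ↔ M.src e = ℓ ∨ M.tgt e = ℓ := by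
  simp [areaLines]

theorem mem_ties {e : M.Line} : e ∈ M.ties ↔ M.src e ≠ M.tgt e := by simp [ties]

theorem mem_tie {ℓ j : Fin L} {e : M.Line} : e ∈ M.tie ℓ j ↔
    ℓ ≠ j ∧ ((M.src e = ℓ ∧ M.tgt e = j) ∨ (M.src e = j ∧ M.tgt e = ℓ)) := by
  simp [tie]

theorem mem_areaLines_src (e : M.Line) : e ∈ M.areaLines (M.src e) := mem_areaLines.2 (.inl rfl)

theorem mem_areaLines_tgt (e : M.Line) : e ∈ M.areaLines (M.tgt e) := mem_areaLines.2 (.inr rfl)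

theorem mem_tie_src_tgt (e : M.ties) : e.1 ∈ M.tie (M.src e.1) (M.tgt e.1) :=
  mem_tie.2 ⟨mem_ties.1 e.2, .inl ⟨rfl, rfl⟩⟩

theorem mem_tie_tgt_src (e : M.ties) : e.1 ∈ M.tie (M.tgt e.1) (M.src e.1) :=
  mem_tie.2 ⟨(mem_ties.1 e.2).symm, .inr ⟨rfl, rfl⟩⟩

/-- Exchange of the order of summation between pairs of areas and tie lines. -/
theorem sum_tie_comm (S : Finset (Fin L × Fin L)) (g : (ℓ j : Fin L) → M.tie ℓ j → ℝ) :
    ∑ q ∈ S, ∑ e, g q.1 q.2 e = ∑ e : M.ties, ∑ q ∈ S,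
      if h : e.1 ∈ M.tie q.1 q.2 then g q.1 q.2 ⟨e.1, h⟩ else 0 := by
  rw [Finset.sum_comm]
  refine Finset.sum_congr rfl fun q _ => ?_
  have h1 : ∑ e, g q.1 q.2 e = ∑ e : M.tie q.1 q.2,
      (fun e : M.Line => if h : e ∈ M.tie q.1 q.2 then g q.1 q.2 ⟨e, h⟩ else 0) e :=
    Finset.sum_congr rfl fun e _ => by simp only [e.2, dif_pos]
  rw [h1, Finset.sum_coe_sort (M.tie q.1 q.2)
    (fun e : M.Line => if h : e ∈ M.tie q.1 q.2 then g q.1 q.2 ⟨e, h⟩ else 0),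
    Finset.sum_coe_sort M.ties
    (fun e : M.Line => if h : e ∈ M.tie q.1 q.2 then g q.1 q.2 ⟨e, h⟩ else 0)]
  exact Finset.sum_subset (M.tie_sub_ties _ _) fun e _ he => dif_neg he

/-- Each tie line occurs exactly twice, once for each order of its two areas. -/
theorem sum_neighbors_tie (g : (ℓ j : Fin L) → M.tie ℓ j → ℝ) :
    ∑ ℓ, ∑ j ∈ M.neighbors ℓ, ∑ e, g ℓ j e = ∑ e : M.ties,
      (g (M.src e.1) (M.tgt e.1) ⟨e.1, mem_tie_src_tgt e⟩
        + g (M.tgt e.1) (M.src e.1) ⟨e.1, mem_tie_tgt_src e⟩) := by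
  have h1 : ∀ ℓ, ∑ j ∈ M.neighbors ℓ, ∑ e, g ℓ j e = ∑ j, ∑ e, g ℓ j e := fun ℓ => by
    refine Finset.sum_subset (Finset.subset_univ _) fun j _ hj => ?_
    refine Finset.sum_eq_zero fun e _ => absurd ?_ hj
    simp only [neighbors, Finset.mem_filter, Finset.mem_univ, true_and]
    exact ⟨e.1, e.2⟩
  simp only [h1]
  rw [← Finset.sum_product' Finset.univ Finset.univ fun ℓ j => ∑ e, g ℓ j e,
    Finset.univ_product_univ, sum_tie_comm]
  refine Finset.sum_congr rfl fun e _ => ?_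
  have hne : (M.src e.1, M.tgt e.1) ≠ (M.tgt e.1, M.src e.1) := fun h =>
    mem_ties.1 e.2 (Prod.ext_iff.1 h).1
  rw [← Finset.sum_subset (Finset.subset_univ {(M.src e.1, M.tgt e.1), (M.tgt e.1, M.src e.1)}),
    Finset.sum_pair hne, dif_pos (mem_tie_src_tgt e), dif_pos (mem_tie_tgt_src e)]
  rintro ⟨ℓ, j⟩ _ hq
  refine dif_neg fun h => hq ?_
  simp only [Finset.mem_insert, Finset.mem_singleton, Prod.mk.injEq]
  rcases (mem_tie.1 h).2 with ⟨h1, h2⟩ | ⟨h1, h2⟩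
  · exact .inl ⟨h1.symm, h2.symm⟩
  · exact .inr ⟨h2.symm, h1.symm⟩

/-- Each tie line occurs exactly once, for the increasing order of its two areas. -/
theorem sum_lt_tie (g : (ℓ j : Fin L) → M.tie ℓ j → ℝ) (f : M.ties → ℝ)
    (hgf : ∀ ℓ j (e : M.tie ℓ j), g ℓ j e = f ⟨e.1, M.tie_sub_ties ℓ j e.2⟩) :
    ∑ ℓ, ∑ j with ℓ < j, ∑ e, g ℓ j e = ∑ e, f e := by
  have h1 : ∑ ℓ, ∑ j with ℓ < j, ∑ e, g ℓ j e
      = ∑ q : Fin L × Fin L with q.1 < q.2, ∑ e, g q.1 q.2 e := by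
    simp only [Finset.sum_filter]
    rw [← Finset.sum_product' Finset.univ Finset.univ fun ℓ j =>
      if ℓ < j then ∑ e, g ℓ j e else 0]
    rfl
  rw [h1, sum_tie_comm]
  refine Finset.sum_congr rfl fun e _ => ?_
  simp only [hgf]
  rw [← Finset.sum_filter_add_sum_filter_not _ fun q : Fin L × Fin L => e.1 ∈ M.tie q.1 q.2]
  have hz : ∀ q ∈ ({q ∈ ({q | q.1 < q.2} : Finset (Fin L × Fin L)) |
      ¬ e.1 ∈ M.tie q.1 q.2} : Finset (Fin L × Fin L)),
      (if h : e.1 ∈ M.tie q.1 q.2 then f ⟨e.1, M.tie_sub_ties _ _ h⟩ else 0) = 0 :=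
    fun q hq => dif_neg (Finset.mem_filter.1 hq).2
  rw [Finset.sum_eq_zero hz, add_zero]
  have hs : ({q ∈ ({q | q.1 < q.2} : Finset (Fin L × Fin L)) |
      e.1 ∈ M.tie q.1 q.2} : Finset (Fin L × Fin L))
      = {(min (M.src e.1) (M.tgt e.1), max (M.src e.1) (M.tgt e.1))} := by
    ext ⟨ℓ, j⟩
    simp only [Finset.mem_filter, Finset.mem_univ, true_and, Finset.mem_singleton,
      Prod.mk.injEq, mem_tie]
    have hne := mem_ties.1 e.2
    constructor
    · rintro ⟨hlt, -, ⟨rfl, rfl⟩ | ⟨rfl, rfl⟩⟩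
      · exact ⟨(min_eq_left hlt.le).symm, (max_eq_right hlt.le).symm⟩
      · exact ⟨(min_eq_right hlt.le).symm, (max_eq_left hlt.le).symm⟩
    · rintro ⟨rfl, rfl⟩
      refine ⟨min_lt_max.2 hne, (min_lt_max.2 hne).ne, ?_⟩
      rcases le_total (M.src e.1) (M.tgt e.1) with h | h
      · exact .inl ⟨(min_eq_left h).symm, (max_eq_right h).symm⟩
      · exact .inr ⟨(max_eq_left h).symm, (min_eq_right h).symm⟩
  have hmem : e.1 ∈ M.tie (min (M.src e.1) (M.tgt e.1)) (max (M.src e.1) (M.tgt e.1)) := by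
    have : ((min (M.src e.1) (M.tgt e.1), max (M.src e.1) (M.tgt e.1)) : Fin L × Fin L) ∈
      ({q ∈ ({q | q.1 < q.2} : Finset (Fin L × Fin L)) |
        e.1 ∈ M.tie q.1 q.2} : Finset (Fin L × Fin L)) := by rw [hs]; simp
    exact (Finset.mem_filter.1 this).2
  rw [hs, Finset.sum_singleton, dif_pos hmem]

variable (M)

/-! ### The consensus form of the centralized problem -/

/-- Separate variables for every area, and copies of the currents on the tie lines. -/
abbrev CopyVar : Type := ((ℓ : Fin L) → M.AreaVar ℓ) × M.Vec M.ties

/-- Three vectors of currents for every tie line. -/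
abbrev Copies : Type := PiLp 2 fun e : M.ties => PiLp 2 fun _ : Fin 3 => M.LineVec e.1

/-- The currents on the tie lines according to the area of their start, the area of their end, and
the additional copies. -/
noncomputable def copies : M.CopyVar →ₗ[ℝ] M.Copies where
  toFun x := WithLp.toLp 2 fun e => WithLp.toLp 2
    ![(x.1 (M.src e.1)).1 ⟨e.1, mem_areaLines_src e.1⟩,
      (x.1 (M.tgt e.1)).1 ⟨e.1, mem_areaLines_tgt e.1⟩, x.2 e]
  map_add' x y := by
    ext e i : 2
    fin_cases i <;> rfl
  map_smul' c x := by
    ext e i : 2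
    fin_cases i <;> rfl

/-- All copies agree. -/
def consensus : Submodule ℝ M.Copies where
  carrier := {h | ∀ e i, h e i = h e 0}
  add_mem' {a b} ha hb e i := by
    simp only [PiLp.add_apply, ha e i, hb e i]
  zero_mem' e i := rfl
  smul_mem' c a ha e i := by
    simp only [PiLp.smul_apply, ha e i]

variable {M}

theorem mem_consensus {h : M.Copies} : h ∈ M.consensus ↔ ∀ e i, h e i = h e 0 := Iff.rfl

theorem mem_consensus_orthogonal {h : M.Copies} (hh : ∀ e, h e 0 + h e 1 + h e 2 = 0) :
    h ∈ M.consensusᗮ := by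
  rw [Submodule.mem_orthogonal]
  intro v hv
  rw [PiLp.inner_apply]
  refine Finset.sum_eq_zero fun e _ => ?_
  rw [PiLp.inner_apply, Fin.sum_univ_three, hv e 1, hv e 2, ← inner_add_right, ← inner_add_right,
    hh, inner_zero_right]

/-- Copies are in consensus if the areas that work with a tie line agree on its current. -/
theorem copies_mem_consensus {x : M.CopyVar} : M.copies x ∈ M.consensus ↔
    ∀ e : M.ties,
      (x.1 (M.tgt e.1)).1 ⟨e.1, mem_areaLines_tgt e.1⟩
        = (x.1 (M.src e.1)).1 ⟨e.1, mem_areaLines_src e.1⟩ ∧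
      x.2 e = (x.1 (M.src e.1)).1 ⟨e.1, mem_areaLines_src e.1⟩ := by
  rw [mem_consensus]
  refine forall_congr' fun e => ?_
  rw [Fin.forall_fin_succ, Fin.forall_fin_succ, Fin.forall_fin_succ]
  constructor
  · rintro ⟨-, h1, h2, -⟩
    exact ⟨h1, h2⟩
  · rintro ⟨h1, h2⟩
    exact ⟨rfl, h1, h2, fun i => i.elim0⟩

variable (M)

/-- Feasible set of the consensus form. -/
def copyFeasibleSet : Set M.CopyVar :=
  {x | (∀ ℓ, x.1 ℓ ∈ M.areaFeasibleSet ℓ) ∧ x.2 ∈ M.magnitudeSet M.ties}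

/-- The point of the consensus form given by a point of the centralized problem. -/
def toCopies (x : M.Var) : M.CopyVar :=
  (fun ℓ => M.toArea ℓ x, M.sub (Finset.subset_univ _) x.1)

theorem copies_toCopies (x : M.Var) : M.copies (M.toCopies x) ∈ M.consensus :=
  copies_mem_consensus.2 fun _ => ⟨rfl, rfl⟩

/-- Every line that meets a node of area `ℓ` belongs to `areaLines ℓ`, so the lines left out
contribute zero. -/
theorem injection_toArea {ℓ : Fin L} (x : M.Var) {n : Fin N} (hn : M.area n = ℓ) (φ : Phase)
    (i : Fin 2) : M.injection (M.toArea ℓ x).1 n φ i = M.injection x.1 n φ i := by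
  have key : ∀ (p : M.Line → Prop) [DecidablePred p] (f : M.Line → ℝ),
      (∀ e, p e → e ∈ M.areaLines ℓ) →
      (∑ e : M.areaLines ℓ, if p e.1 then f e.1 else 0)
        = ∑ e : (Finset.univ : Finset M.Line), if p e.1 then f e.1 else 0 := by
    intro p _ f hp
    rw [Finset.sum_coe_sort (M.areaLines ℓ) (fun e => if p e then f e else 0),
      Finset.sum_coe_sort Finset.univ (fun e => if p e then f e else 0)]
    exact Finset.sum_subset (Finset.subset_univ _) fun e _ he => if_neg fun h => he (hp e h)
  unfold injection
  congr 1
  · exact key (fun e => e.1.1 = n ∧ φ ∈ M.nodePhases n)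
      (fun e => M.phaseCurrent (x.1 ⟨e, Finset.mem_univ e⟩) φ i)
      fun e he => mem_areaLines.2 (.inl (by rw [src, he.1, hn]))
  · exact key (fun e => e.1.2 = n ∧ φ ∈ M.nodePhases n)
      (fun e => M.phaseCurrent (x.1 ⟨e, Finset.mem_univ e⟩) φ i)
      fun e he => mem_areaLines.2 (.inr (by rw [tgt, he.1, hn]))

theorem dgPower_toArea {ℓ : Fin L} (x : M.Var) {n : Fin N} (hn : M.area n = ℓ) (φ : Phase)
    (i : Fin 2) : M.dgPower (M.toArea ℓ x).2 n φ i = M.dgPower x.2 n φ i := by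
  unfold dgPower
  by_cases h : (n, φ) ∈ M.dgs
  · rw [dif_pos h, dif_pos (show (n, φ) ∈ M.areaDGs ℓ by simp [areaDGs, h, hn])]
    rfl
  · rw [dif_neg h, dif_neg fun h' => h (M.areaDGs_sub ℓ h')]

theorem toArea_mem_areaFeasibleSet {x : M.Var} (hx : x ∈ M.feasibleSet) (ℓ : Fin L) :
    M.toArea ℓ x ∈ M.areaFeasibleSet ℓ where
  loadSat n hn φ hφ i := by
    have hn : M.area n = ℓ := by simpa [areaNodes] using hn
    have h1 : M.injection (M.toArea ℓ x).1 n φ = M.injection x.1 n φ :=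
      funext fun i => M.injection_toArea x hn φ i
    rw [h1, M.dgPower_toArea x hn]
    exact hx.loadSat n (Finset.mem_univ n) φ hφ i
  magnitude e φ := hx.magnitude ⟨e.1, Finset.mem_univ _⟩ φ
  zeroCurrent n hn φ hφ hφ' i := by
    have hn : M.area n = ℓ := by simpa [areaNodes] using hn
    rw [M.injection_toArea x hn]
    exact hx.zeroCurrent n (Finset.mem_univ n) φ hφ hφ' i
  dgBox g i := hx.dgBox ⟨g.1, M.areaDGs_sub ℓ g.2⟩ i

theorem mem_feasibleSet_of_toArea {x : M.Var} (hx : ∀ ℓ, M.toArea ℓ x ∈ M.areaFeasibleSet ℓ) :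
    x ∈ M.feasibleSet where
  loadSat n _ φ hφ i := by
    have h1 : M.injection (M.toArea (M.area n) x).1 n φ = M.injection x.1 n φ :=
      funext fun i => M.injection_toArea x rfl φ i
    rw [← h1, ← M.dgPower_toArea x rfl]
    exact (hx (M.area n)).loadSat n (by simp [areaNodes]) φ hφ i
  magnitude e φ := (hx (M.src e.1)).magnitude ⟨e.1, mem_areaLines_src e.1⟩ φ
  zeroCurrent n _ φ hφ hφ' i := by
    rw [← M.injection_toArea x rfl]
    exact (hx (M.area n)).zeroCurrent n (by simp [areaNodes]) φ hφ hφ' i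
  dgBox g i := (hx (M.area g.1.1)).dgBox ⟨g.1, by simp [areaDGs, g.2]⟩ i

theorem toCopies_mem_copyFeasibleSet {x : M.Var} (hx : x ∈ M.feasibleSet) :
    M.toCopies x ∈ M.copyFeasibleSet :=
  ⟨M.toArea_mem_areaFeasibleSet hx, fun e φ => hx.magnitude ⟨e.1, Finset.mem_univ _⟩ φ⟩

/-- Copies in consensus come from a point of the centralized problem. -/
theorem exists_toCopies_eq {x : M.CopyVar} (hx : x ∈ M.copyFeasibleSet)
    (hc : M.copies x ∈ M.consensus) : ∃ y ∈ M.feasibleSet, M.toCopies y = x := by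
  rw [copies_mem_consensus] at hc
  -- Each current is read off in the area where its line starts. Consensus is needed only where the
  -- other area of a tie line, or `χ`, has to agree.
  let y : M.Var := (fun e => (x.1 (M.src e.1)).1 ⟨e.1, mem_areaLines_src e.1⟩,
    fun g => (x.1 (M.area g.1.1)).2 ⟨g.1, by simp [areaDGs, g.2]⟩)
  have hy : ∀ ℓ, M.toArea ℓ y = x.1 ℓ := by
    intro ℓ
    refine Prod.ext (funext fun e => ?_) (funext fun g => ?_)
    · obtain ⟨e, he⟩ := e
      change (x.1 (M.src e)).1 ⟨e, mem_areaLines_src e⟩ = _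
      by_cases hs : M.src e = ℓ
      · subst hs; rfl
      · have ht := (mem_areaLines.1 he).resolve_left hs
        subst ht
        exact (hc ⟨e, mem_ties.2 hs⟩).1.symm
    · obtain ⟨g, hg⟩ := g
      have hgℓ : M.area g.1 = ℓ := (Finset.mem_filter.1 hg).2
      subst hgℓ
      rfl
  refine ⟨y, M.mem_feasibleSet_of_toArea fun ℓ => by rw [hy]; exact hx.1 ℓ, ?_⟩
  exact Prod.ext (funext hy) (funext fun e => (hc e).2.symm)

theorem convex_copyFeasibleSet : Convex ℝ M.copyFeasibleSet := fun _ hx _ hy _ _ ha hb hab =>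
  ⟨fun ℓ => M.convex_areaFeasibleSet ℓ (hx.1 ℓ) (hy.1 ℓ) ha hb hab,
    M.convex_magnitudeSet _ hx.2 hy.2 ha hb hab⟩

theorem isClosed_copyFeasibleSet : IsClosed M.copyFeasibleSet := by
  have h : M.copyFeasibleSet = (⋂ ℓ, (fun x : M.CopyVar => x.1 ℓ) ⁻¹' M.areaFeasibleSet ℓ) ∩
      Prod.snd ⁻¹' M.magnitudeSet M.ties := by
    ext x; simp [copyFeasibleSet]
  rw [h]
  exact (isClosed_iInter fun ℓ => (M.isClosed_areaFeasibleSet ℓ).preimage (by fun_prop)).inter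
    ((M.isClosed_magnitudeSet _).preimage continuous_snd)

/-- Cost of an area in the consensus form. -/
noncomputable def areaCost (Carea : (ℓ : Fin L) → M.AreaVar ℓ → ℝ) (lam : M.Line → ℝ) (ℓ : Fin L)
    (x : M.AreaVar ℓ) : ℝ :=
  Carea ℓ x + ∑ e : M.areaLines ℓ,
    if e.1.1 ∈ M.switchable ∧ M.area e.1.1.1 = ℓ ∧ M.area e.1.1.2 = ℓ
      then lam e.1 * ‖x.1 e‖ else 0

/-- Cost of the copies for the lines connecting two areas. -/
noncomputable def tieCost (Ctie : (ℓ j : Fin L) → M.Vec (M.tie ℓ j) → ℝ) (lam : M.Line → ℝ)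
    (ℓ j : Fin L) (χ : M.Vec (M.tie ℓ j)) : ℝ :=
  Ctie ℓ j χ + ∑ e, lam e.1 * ‖χ e‖

/-- Objective of the consensus form. -/
noncomputable def copyCost (Carea : (ℓ : Fin L) → M.AreaVar ℓ → ℝ)
    (Ctie : (ℓ j : Fin L) → M.Vec (M.tie ℓ j) → ℝ) (lam : M.Line → ℝ) (x : M.CopyVar) : ℝ :=
  (∑ ℓ, M.areaCost Carea lam ℓ (x.1 ℓ))
    + ∑ ℓ, ∑ j with ℓ < j, M.tieCost Ctie lam ℓ j (M.sub (M.tie_sub_ties ℓ j) x.2)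

variable {M} {C : M.Var → ℝ} {Carea : (ℓ : Fin L) → M.AreaVar ℓ → ℝ}
  {Ctie : (ℓ j : Fin L) → M.Vec (M.tie ℓ j) → ℝ} {lam : M.Line → ℝ}

theorem convexOn_sum_mul_norm {S : Finset M.Line} (p : S → Prop) [DecidablePred p]
    (hlam : ∀ e, 0 ≤ lam e) :
    ConvexOn ℝ Set.univ fun x : M.Vec S => ∑ e, if p e then lam e.1 * ‖x e‖ else 0 := by
  have h : (fun x : M.Vec S => ∑ e, if p e then lam e.1 * ‖x e‖ else 0)
      = ∑ e, fun x : M.Vec S => if p e then lam e.1 * ‖x e‖ else 0 := by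
    ext x; simp
  rw [h]
  refine Finset.sum_induction _ (ConvexOn ℝ Set.univ) (fun _ _ => ConvexOn.add)
    (convexOn_const 0 convex_univ) fun e _ => ?_
  split_ifs
  · exact ((convexOn_norm convex_univ).comp_linearMap
      (LinearMap.proj e : M.Vec S →ₗ[ℝ] M.LineVec e.1)).smul (hlam e.1)
  · exact convexOn_const 0 convex_univ

theorem convexOn_areaCost (hCarea : ∀ ℓ, ConvexOn ℝ Set.univ (Carea ℓ))
    (hlam : ∀ e, 0 ≤ lam e) (ℓ : Fin L) : ConvexOn ℝ Set.univ (M.areaCost Carea lam ℓ) :=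
  (hCarea ℓ).add ((convexOn_sum_mul_norm _ hlam).comp_linearMap
    (LinearMap.fst ℝ (M.Vec (M.areaLines ℓ)) (M.DGVec (M.areaDGs ℓ))))

theorem convexOn_tieCost (hCtie : ∀ ℓ j, ℓ < j → ConvexOn ℝ Set.univ (Ctie ℓ j))
    (hlam : ∀ e, 0 ≤ lam e) {ℓ j : Fin L} (hℓj : ℓ < j) :
    ConvexOn ℝ Set.univ (M.tieCost Ctie lam ℓ j) := by
  refine (hCtie ℓ j hℓj).add ?_
  simpa using convexOn_sum_mul_norm (S := M.tie ℓ j) (fun _ => True) hlam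

theorem convexOn_copyCost (hCarea : ∀ ℓ, ConvexOn ℝ Set.univ (Carea ℓ))
    (hCtie : ∀ ℓ j, ℓ < j → ConvexOn ℝ Set.univ (Ctie ℓ j)) (hlam : ∀ e, 0 ≤ lam e) :
    ConvexOn ℝ Set.univ (M.copyCost Carea Ctie lam) := by
  have hsum : ∀ {ι : Type} (s : Finset ι) (f : ι → M.CopyVar → ℝ),
      (∀ i ∈ s, ConvexOn ℝ Set.univ (f i)) → ConvexOn ℝ Set.univ fun x => ∑ i ∈ s, f i x := by
    intro ι s f hf
    have h : (fun x => ∑ i ∈ s, f i x) = ∑ i ∈ s, f i := by ext x; simp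
    rw [h]
    exact Finset.sum_induction _ (ConvexOn ℝ Set.univ) (fun _ _ => ConvexOn.add)
      (convexOn_const 0 convex_univ) hf
  refine (hsum _ _ fun ℓ _ => ?_).add (hsum _ _ fun ℓ _ => hsum _ _ fun j hj => ?_)
  · exact (convexOn_areaCost hCarea hlam ℓ).comp_linearMap
      ((LinearMap.proj ℓ : ((ℓ : Fin L) → M.AreaVar ℓ) →ₗ[ℝ] M.AreaVar ℓ).comp
        (LinearMap.fst ℝ _ (M.Vec M.ties)))
  · let f : M.CopyVar →ₗ[ℝ] M.Vec (M.tie ℓ j) :=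
      { toFun := fun x => M.sub (M.tie_sub_ties ℓ j) x.2
        map_add' := fun _ _ => rfl
        map_smul' := fun _ _ => rfl }
    exact (convexOn_tieCost hCtie hlam (Finset.mem_filter.1 hj).2).comp_linearMap f

/-- The objectives of the centralized problem and of its consensus form agree. -/
theorem copyCost_toCopies (hC : ∀ x : M.Var, C x = (∑ ℓ, Carea ℓ (M.toArea ℓ x))
      + ∑ ℓ, ∑ j with ℓ < j, Ctie ℓ j (M.sub (Finset.subset_univ _) x.1)) (x : M.Var) :
    M.copyCost Carea Ctie lam (M.toCopies x) = C x + M.groupLasso lam x.1 := by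
  let f : M.Line → ℝ := fun e => lam e * ‖x.1 ⟨e, Finset.mem_univ e⟩‖
  have h1 : ∑ ℓ, ∑ j with ℓ < j, ∑ e : M.tie ℓ j, f e.1 = ∑ e : M.ties, f e.1 :=
    sum_lt_tie (fun ℓ j e => f e.1) (fun e => f e.1) fun _ _ _ => rfl
  have h2 : ∀ ℓ, (∑ e : M.areaLines ℓ,
      if e.1.1 ∈ M.switchable ∧ M.area e.1.1.1 = ℓ ∧ M.area e.1.1.2 = ℓ then f e.1 else 0)
      = ∑ e : M.Line, if e.1 ∈ M.switchable ∧ M.src e = ℓ ∧ M.tgt e = ℓ then f e else 0 := by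
    intro ℓ
    rw [Finset.sum_coe_sort (M.areaLines ℓ) (fun e =>
      if e.1 ∈ M.switchable ∧ M.area e.1.1 = ℓ ∧ M.area e.1.2 = ℓ then f e else 0)]
    exact Finset.sum_subset (Finset.subset_univ _) fun e _ he =>
      if_neg fun h => he (mem_areaLines.2 (.inl h.2.1))
  have h3 : M.groupLasso lam x.1 = ∑ e : M.Line, if e.1 ∈ M.switchable then f e else 0 :=
    Finset.sum_coe_sort Finset.univ fun e : M.Line => if e.1 ∈ M.switchable then f e else 0
  have h4 : ∑ e : M.ties, f e.1 = ∑ e : M.Line, if e ∈ M.ties then f e else 0 := by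
    rw [Finset.sum_coe_sort M.ties f, Finset.sum_ite_mem, Finset.univ_inter]
  -- A switchable line inside an area is charged to that area, a tie line to its copy `χ`. All tie
  -- lines are switchable, so the charges add up to the full regularizer.
  have h5 : (∑ ℓ, ∑ e : M.areaLines ℓ,
      if e.1.1 ∈ M.switchable ∧ M.area e.1.1.1 = ℓ ∧ M.area e.1.1.2 = ℓ then f e.1 else 0)
      + ∑ ℓ, ∑ j with ℓ < j, ∑ e : M.tie ℓ j, f e.1 = M.groupLasso lam x.1 := by
    rw [h1, h3, h4, Finset.sum_congr rfl fun ℓ _ => h2 ℓ, Finset.sum_comm,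
      ← Finset.sum_add_distrib]
    refine Finset.sum_congr rfl fun e _ => ?_
    by_cases ht : e ∈ M.ties
    · have hne := mem_ties.1 ht
      rw [if_pos ht, if_pos (M.switchable_of_tie e.1 e.2 hne), Finset.sum_eq_zero, zero_add]
      intro ℓ _
      exact if_neg fun h => hne (h.2.1.trans h.2.2.symm)
    · have heq : M.src e = M.tgt e := not_not.1 fun h => ht (mem_ties.2 h)
      rw [if_neg ht, add_zero, Finset.sum_eq_single (M.src e)]
      · simp only [heq, and_self, and_true]
      · intro ℓ _ hℓ
        exact if_neg fun h => hℓ h.2.1.symm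
      · exact fun h => absurd (Finset.mem_univ _) h
  rw [hC, ← h5]
  unfold copyCost areaCost tieCost
  simp only [Finset.sum_add_distrib]
  exact add_add_add_comm _ _ _ _

/-- The optimal solution of the consensus form. -/
theorem copyCost_le (hC : ∀ x : M.Var, C x = (∑ ℓ, Carea ℓ (M.toArea ℓ x))
      + ∑ ℓ, ∑ j with ℓ < j, Ctie ℓ j (M.sub (Finset.subset_univ _) x.1))
    {xopt : M.Var} (hopt : M.IsOptimal C lam xopt) {x : M.CopyVar} (hx : x ∈ M.copyFeasibleSet)
    (hc : M.copies x ∈ M.consensus) :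
    M.copyCost Carea Ctie lam (M.toCopies xopt) ≤ M.copyCost Carea Ctie lam x := by
  obtain ⟨y, hy, rfl⟩ := M.exists_toCopies_eq hx hc
  rw [copyCost_toCopies hC, copyCost_toCopies hC]
  exact hopt.2 hy

/-- Uniqueness of the optimal solution of the consensus form. -/
theorem eq_toCopies_of_copyCost_le (hC : ∀ x : M.Var, C x = (∑ ℓ, Carea ℓ (M.toArea ℓ x))
      + ∑ ℓ, ∑ j with ℓ < j, Ctie ℓ j (M.sub (Finset.subset_univ _) x.1))
    {xopt : M.Var} (hopt : M.IsOptimal C lam xopt) (huniq : ∀ y, M.IsOptimal C lam y → y = xopt)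
    {x : M.CopyVar} (hx : x ∈ M.copyFeasibleSet) (hc : M.copies x ∈ M.consensus)
    (hle : M.copyCost Carea Ctie lam x ≤ M.copyCost Carea Ctie lam (M.toCopies xopt)) :
    x = M.toCopies xopt := by
  obtain ⟨y, hy, rfl⟩ := M.exists_toCopies_eq hx hc
  rw [copyCost_toCopies hC, copyCost_toCopies hC] at hle
  rw [huniq y ⟨hy, fun w hw => hle.trans (hopt.2 hw)⟩]

/-- Existence of multipliers for the consensus form. -/
theorem exists_consensus_multiplier (hC : ∀ x : M.Var, C x = (∑ ℓ, Carea ℓ (M.toArea ℓ x))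
      + ∑ ℓ, ∑ j with ℓ < j, Ctie ℓ j (M.sub (Finset.subset_univ _) x.1))
    (hCarea : ∀ ℓ, ConvexOn ℝ Set.univ (Carea ℓ))
    (hCtie : ∀ ℓ j, ℓ < j → ConvexOn ℝ Set.univ (Ctie ℓ j)) (hlam : ∀ e, 0 ≤ lam e)
    (hslater : M.Slater) {xopt : M.Var} (hopt : M.IsOptimal C lam xopt) :
    ∃ v ∈ M.consensusᗮ, ∀ x ∈ M.copyFeasibleSet,
      M.copyCost Carea Ctie lam (M.toCopies xopt)
        ≤ M.copyCost Carea Ctie lam x + inner ℝ v (M.copies x) := by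
  -- Only the current limits enter `Q`, the set whose interior must contain the Slater point.
  let P : Set M.CopyVar :=
    {x | ∀ ℓ, x.1 ℓ ∈ M.nodalSet (M.areaLines ℓ) (M.areaDGs ℓ) (M.areaNodes ℓ)}
  let Q : Set M.CopyVar :=
    (⋂ ℓ, (fun x : M.CopyVar => (x.1 ℓ).1) ⁻¹' M.magnitudeSet (M.areaLines ℓ)) ∩
      Prod.snd ⁻¹' M.magnitudeSet M.ties
  have hPQ : ∀ x, x ∈ M.copyFeasibleSet ↔ x ∈ P ∧ x ∈ Q := fun x => by
    simp only [copyFeasibleSet, mem_areaFeasibleSet, mem_ofPred_eq, P, Q, mem_inter_iff,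
      mem_iInter, mem_preimage, forall_and, and_assoc]
  have hP : IsPolyhedral P := .all fun ℓ => (M.isPolyhedral_nodalSet _ _ _).preimage
    ((LinearMap.proj ℓ : ((ℓ : Fin L) → M.AreaVar ℓ) →ₗ[ℝ] M.AreaVar ℓ).comp
      (LinearMap.fst ℝ _ (M.Vec M.ties)))
  have hQ : Convex ℝ Q := fun _ hx _ hy _ _ ha hb hab =>
    ⟨mem_iInter.2 fun ℓ => M.convex_magnitudeSet _ (mem_iInter.1 hx.1 ℓ) (mem_iInter.1 hy.1 ℓ)
      ha hb hab, M.convex_magnitudeSet _ hx.2 hy.2 ha hb hab⟩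
  obtain ⟨xs, hxs, hxlt⟩ := hslater
  have hint : M.toCopies xs ∈ interior Q := by
    rw [interior_inter, interior_iInter_of_finite]
    refine ⟨mem_iInter.2 fun ℓ => ?_, ?_⟩
    · exact preimage_interior_subset_interior_preimage (by fun_prop)
        (M.mem_interior_magnitudeSet fun e φ => hxlt ⟨e.1, Finset.mem_univ _⟩ φ)
    · exact preimage_interior_subset_interior_preimage continuous_snd
        (M.mem_interior_magnitudeSet fun e φ => hxlt ⟨e.1, Finset.mem_univ _⟩ φ)
  have ho := (hPQ _).1 (M.toCopies_mem_copyFeasibleSet hopt.1)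
  have hs := (hPQ _).1 (M.toCopies_mem_copyFeasibleSet hxs)
  have hF := convexOn_copyCost hCarea hCtie hlam
  obtain ⟨v, hv, hvm⟩ := exists_multiplier hF hF.continuous_of_univ hP hQ M.copies M.consensus
    ho.1 ho.2 (M.copies_toCopies xopt) hs.1 hint (M.copies_toCopies xs)
    fun x hxP hxQ hxc => copyCost_le hC hopt ((hPQ x).2 ⟨hxP, hxQ⟩) hxc
  exact ⟨v, hv, fun x hx => hvm x ((hPQ x).1 hx).1 ((hPQ x).1 hx).2⟩

end Microgrid

namespace Microgrid

variable {N L K : ℕ} {M : Microgrid N L K}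

/-! ### The algorithm as an instance of ADMM -/

/-- The primal variables of a state. -/
def State.toVar (X : M.State) : M.CopyVar := (fun ℓ => (X.ξ ℓ, X.s ℓ), X.χ)

/-- The multipliers of a state. -/
noncomputable def State.dual (X : M.State) : M.Copies :=
  WithLp.toLp 2 fun e => WithLp.toLp 2
    -- The sign of `μ` matches the term `-χᵀ μ` in the subproblem of the copies.
    ![X.γ _ _ ⟨e.1, mem_tie_src_tgt e⟩, X.γ _ _ ⟨e.1, mem_tie_tgt_src e⟩, -X.μ e]

/-- The sum of the three copies of the current on a tie line. -/
noncomputable def State.total (X : M.State) (e : M.ties) : M.LineVec e.1 :=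
  X.ξ _ ⟨e.1, mem_areaLines_src e.1⟩ + X.ξ _ ⟨e.1, mem_areaLines_tgt e.1⟩ + X.χ e

/-- The consensus variables of a state: averages of the three copies. -/
noncomputable def State.avg (X : M.State) : M.Copies :=
  WithLp.toLp 2 fun e => WithLp.toLp 2 fun _ => (1 / 3 : ℝ) • X.total e

/-- The sum is symmetric in the two areas, so it does not depend on the orientation of the line. -/
theorem State.tie_total (X : M.State) {ℓ j : Fin L} (e : M.tie ℓ j) :
    (X.ξl ℓ j + X.ξr ℓ j + X.χt ℓ j) e = X.total ⟨e.1, M.tie_sub_ties ℓ j e.2⟩ := by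
  obtain ⟨e, he⟩ := e
  rcases (mem_tie.1 he).2 with ⟨rfl, rfl⟩ | ⟨rfl, rfl⟩
  · rfl
  · exact congrArg (· + X.χ ⟨e, M.tie_sub_ties _ _ he⟩) (add_comm _ _)

variable {Carea : (ℓ : Fin L) → M.AreaVar ℓ → ℝ}
  {Ctie : (ℓ j : Fin L) → M.Vec (M.tie ℓ j) → ℝ} {lam : M.Line → ℝ} {κ : ℝ}

/-- The part of the objective of an area's subproblem that stems from one tie line. -/
noncomputable def areaTerm (κ : ℝ) (X : M.State) (ℓ j : Fin L) (x : M.Vec (M.areaLines ℓ))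
    (e : M.tie ℓ j) : ℝ :=
  inner ℝ (X.γ ℓ j e) (x ⟨e.1, M.tie_sub_left ℓ j e.2⟩)
    + κ / 2 * ‖x ⟨e.1, M.tie_sub_left ℓ j e.2⟩‖ ^ 2
    - κ / 3 * inner ℝ (x ⟨e.1, M.tie_sub_left ℓ j e.2⟩)
        (X.total ⟨e.1, M.tie_sub_ties ℓ j e.2⟩)

theorem areaObj_eq (X : M.State) (ℓ : Fin L) (x : M.AreaVar ℓ) :
    M.areaObj Carea lam κ X ℓ x = M.areaCost Carea lam ℓ x
      + ∑ j ∈ M.neighbors ℓ, ∑ e, areaTerm κ X ℓ j x.1 e := by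
  unfold areaObj areaCost areaTerm ip normSq
  congr 1
  refine Finset.sum_congr rfl fun j _ => ?_
  simp only [Finset.mul_sum, ← Finset.sum_add_distrib, ← Finset.sum_sub_distrib,
    State.tie_total]
  rfl

/-- The part of the objective of a tie's subproblem that stems from one line. -/
noncomputable def tieTerm (κ : ℝ) (X : M.State) (e : M.ties) (v : M.LineVec e.1) : ℝ :=
  κ / 2 * ‖v‖ ^ 2 - inner ℝ v (X.μ e + (κ / 3) • X.total e)

theorem tieObj_eq (X : M.State) (ℓ j : Fin L) (χ : M.Vec (M.tie ℓ j)) :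
    M.tieObj Ctie lam κ X ℓ j χ = M.tieCost Ctie lam ℓ j χ
      + ∑ e : M.tie ℓ j, tieTerm κ X ⟨e.1, M.tie_sub_ties ℓ j e.2⟩ (χ e) := by
  unfold tieObj tieCost tieTerm ip normSq
  rw [add_sub_assoc]
  congr 1
  simp only [Finset.mul_sum, ← Finset.sum_sub_distrib, Pi.add_apply (X.μt ℓ j), Pi.smul_apply,
    State.tie_total]
  rfl

/-- The subproblems together minimize an augmented Lagrangian. -/
theorem augLagrangian_eq (X : M.State) (x : M.CopyVar) :
    augLagrangian (M.copyCost Carea Ctie lam) M.copies κ X.dual X.avg x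
      = (∑ ℓ, M.areaObj Carea lam κ X ℓ (x.1 ℓ)
        + ∑ ℓ, ∑ j with ℓ < j, M.tieObj Ctie lam κ X ℓ j (M.sub (M.tie_sub_ties ℓ j) x.2))
        + κ / 2 * ‖X.avg‖ ^ 2 := by
  have h1 := sum_neighbors_tie (M := M) fun ℓ j e => areaTerm κ X ℓ j (x.1 ℓ).1 e
  have h2 := sum_lt_tie (M := M) (fun ℓ j e => tieTerm κ X ⟨e.1, M.tie_sub_ties ℓ j e.2⟩
    (M.sub (M.tie_sub_ties ℓ j) x.2 e)) (fun e => tieTerm κ X e (x.2 e)) fun _ _ _ => rfl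
  -- This is the expanded penalty without its constant `κ / 2 * ‖X.avg‖ ^ 2`. Since `avg` is a third
  -- of `total`, the cross term produces the factor `κ / 3`.
  have h3 : inner ℝ X.dual (M.copies x) + κ / 2 * ‖M.copies x‖ ^ 2
      - κ * inner ℝ (M.copies x) X.avg
      = ∑ e : M.ties, (areaTerm κ X _ _ (x.1 (M.src e.1)).1 ⟨e.1, mem_tie_src_tgt e⟩
        + areaTerm κ X _ _ (x.1 (M.tgt e.1)).1 ⟨e.1, mem_tie_tgt_src e⟩)
        + ∑ e, tieTerm κ X e (x.2 e) := by
    rw [PiLp.norm_sq_eq_of_L2, PiLp.inner_apply, PiLp.inner_apply, Finset.mul_sum,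
      Finset.mul_sum, ← Finset.sum_add_distrib, ← Finset.sum_sub_distrib,
      ← Finset.sum_add_distrib]
    refine Finset.sum_congr rfl fun e _ => ?_
    rw [PiLp.norm_sq_eq_of_L2, PiLp.inner_apply, PiLp.inner_apply, Fin.sum_univ_three,
      Fin.sum_univ_three, Fin.sum_univ_three]
    have d0 : X.dual e 0 = X.γ _ _ ⟨e.1, mem_tie_src_tgt e⟩ := rfl
    have d1 : X.dual e 1 = X.γ _ _ ⟨e.1, mem_tie_tgt_src e⟩ := rfl
    have d2 : X.dual e 2 = -X.μ e := rfl
    have c0 : M.copies x e 0 = (x.1 (M.src e.1)).1 ⟨e.1, mem_areaLines_src e.1⟩ := rfl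
    have c1 : M.copies x e 1 = (x.1 (M.tgt e.1)).1 ⟨e.1, mem_areaLines_tgt e.1⟩ := rfl
    have c2 : M.copies x e 2 = x.2 e := rfl
    have hz : ∀ i, X.avg e i = (1 / 3 : ℝ) • X.total e := fun _ => rfl
    rw [d0, d1, d2, c0, c1, c2, hz, hz, hz]
    unfold areaTerm tieTerm
    simp only [inner_add_right, inner_smul_right, inner_neg_left]
    rw [real_inner_comm (x.2 e) (X.μ e)]
    ring
  simp only [areaObj_eq, tieObj_eq, Finset.sum_add_distrib]
  unfold augLagrangian copyCost
  rw [norm_sub_sq_real, h1, h2]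
  linarith

theorem State.avg_mem (X : M.State) : X.avg ∈ M.consensus := fun _ _ => rfl

/-- Deviations from the mean of three copies sum to zero. -/
theorem State.copies_sub_avg_mem (X : M.State) : M.copies X.toVar - X.avg ∈ M.consensusᗮ := by
  refine mem_consensus_orthogonal fun e => ?_
  have c0 : M.copies X.toVar e 0 = X.ξ _ ⟨e.1, mem_areaLines_src e.1⟩ := rfl
  have c1 : M.copies X.toVar e 1 = X.ξ _ ⟨e.1, mem_areaLines_tgt e.1⟩ := rfl
  have c2 : M.copies X.toVar e 2 = X.χ e := rfl
  have hz : ∀ i, X.avg e i = (1 / 3 : ℝ) • X.total e := fun _ => rfl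
  simp only [PiLp.sub_apply, c0, c1, c2, hz, State.total]
  module

namespace Step

variable {X Y : M.State}

theorem toVar_mem (h : M.Step Carea Ctie lam κ X Y) : Y.toVar ∈ M.copyFeasibleSet := by
  refine ⟨fun ℓ => (h.area ℓ).1, fun e φ => ?_⟩
  rcases lt_or_gt_of_ne (mem_ties.1 e.2) with hlt | hlt
  · exact (h.tie _ _ hlt).1 ⟨e.1, mem_tie_src_tgt e⟩ φ
  · exact (h.tie _ _ hlt).1 ⟨e.1, mem_tie_tgt_src e⟩ φ

/-- Given `X`, the augmented Lagrangian is a sum over blocks without common variables, so minimizing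
each block minimizes the whole. -/
theorem isMinOn (h : M.Step Carea Ctie lam κ X Y) :
    IsMinOn (augLagrangian (M.copyCost Carea Ctie lam) M.copies κ X.dual X.avg)
      M.copyFeasibleSet Y.toVar := by
  intro y hy
  simp only [mem_ofPred_eq, augLagrangian_eq]
  gcongr (?_ + ?_) + _
  · exact Finset.sum_le_sum fun ℓ _ => (h.area ℓ).2 (hy.1 ℓ)
  · refine Finset.sum_le_sum fun ℓ _ => Finset.sum_le_sum fun j hj => ?_
    exact (h.tie ℓ j (Finset.mem_filter.1 hj).2).2 fun e φ =>
      hy.2 ⟨e.1, M.tie_sub_ties ℓ j e.2⟩ φ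

/-- Three times the deviation of one copy from the mean is twice that copy minus the other two; for
`χ` the sign of `μ` is reversed. -/
theorem dual_eq (h : M.Step Carea Ctie lam κ X Y) :
    Y.dual = X.dual + κ • (M.copies Y.toVar - Y.avg) := by
  ext e i : 2
  have c0 : M.copies Y.toVar e 0 = Y.ξ _ ⟨e.1, mem_areaLines_src e.1⟩ := rfl
  have c1 : M.copies Y.toVar e 1 = Y.ξ _ ⟨e.1, mem_areaLines_tgt e.1⟩ := rfl
  have c2 : M.copies Y.toVar e 2 = Y.χ e := rfl
  have hz : ∀ i, Y.avg e i = (1 / 3 : ℝ) • Y.total e := fun _ => rfl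
  have hd : ∀ X : M.State, X.dual e 0 = X.γ _ _ ⟨e.1, mem_tie_src_tgt e⟩ ∧
    X.dual e 1 = X.γ _ _ ⟨e.1, mem_tie_tgt_src e⟩ ∧ X.dual e 2 = -X.μ e :=
    fun _ => ⟨rfl, rfl, rfl⟩
  simp only [PiLp.add_apply, PiLp.smul_apply, PiLp.sub_apply, hz, State.total]
  have hi : i = 0 ∨ i = 1 ∨ i = 2 := by fin_cases i <;> simp
  rcases hi with rfl | rfl | rfl
  · rw [(hd X).1, (hd Y).1, c0]
    have : Y.γ _ _ ⟨e.1, mem_tie_src_tgt e⟩ = X.γ _ _ ⟨e.1, mem_tie_src_tgt e⟩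
        + (κ / 3) • ((2 : ℝ) • Y.ξ _ ⟨e.1, mem_areaLines_src e.1⟩
          - Y.ξ _ ⟨e.1, mem_areaLines_tgt e.1⟩ - Y.χ e) := by
      rw [h.dualγ]; rfl
    rw [this]
    module
  · rw [(hd X).2.1, (hd Y).2.1, c1]
    have : Y.γ _ _ ⟨e.1, mem_tie_tgt_src e⟩ = X.γ _ _ ⟨e.1, mem_tie_tgt_src e⟩
        + (κ / 3) • ((2 : ℝ) • Y.ξ _ ⟨e.1, mem_areaLines_tgt e.1⟩
          - Y.ξ _ ⟨e.1, mem_areaLines_src e.1⟩ - Y.χ e) := by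
      rw [h.dualγ]; rfl
    rw [this]
    module
  · rw [(hd X).2.2, (hd Y).2.2, c2]
    have : Y.μ e = X.μ e + (κ / 3) • (Y.ξ _ ⟨e.1, mem_areaLines_src e.1⟩
        + Y.ξ _ ⟨e.1, mem_areaLines_tgt e.1⟩ - (2 : ℝ) • Y.χ e) := by
      rcases lt_or_gt_of_ne (mem_ties.1 e.2) with hlt | hlt
      · exact congrFun (h.dualμ _ _ hlt) ⟨e.1, mem_tie_src_tgt e⟩
      · rw [add_comm (Y.ξ _ _)]
        exact congrFun (h.dualμ _ _ hlt) ⟨e.1, mem_tie_tgt_src e⟩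
    rw [this]
    module

end Step

/-- Zero initial multipliers serve to make `u 0` orthogonal to consensus, which requires `γ + γ - μ
= 0` on each tie line. -/
theorem isADMM_of_step {X : ℕ → M.State} (h0 : (X 0).DualZero)
    (h : ∀ i, M.Step Carea Ctie lam κ (X i) (X (i + 1))) :
    IsADMM M.copyFeasibleSet (M.copyCost Carea Ctie lam) M.copies M.consensus κ
      (fun i => (X i).toVar) (fun i => (X i).avg) (fun i => (X i).dual) where
  mem n := (h n).toVar_mem
  isMinOn n := (h n).isMinOn
  z_mem n := (X n).avg_mem
  residual_mem n := (X (n + 1)).copies_sub_avg_mem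
  u_zero := by
    refine mem_consensus_orthogonal fun e => ?_
    have h1 : (X 0).dual e 0 = (X 0).γ _ _ ⟨e.1, mem_tie_src_tgt e⟩ := rfl
    have h2 : (X 0).dual e 1 = (X 0).γ _ _ ⟨e.1, mem_tie_tgt_src e⟩ := rfl
    have h3 : (X 0).dual e 2 = -(X 0).μ e := rfl
    rw [h1, h2, h3, h0.1, h0.1, h0.2]
    simp
  u_succ n := (h n).dual_eq

/-! ### Solvability of the subproblems -/

theorem isLinearMap_ip {S : Finset M.Line} (y : M.Vec S) :
    IsLinearMap ℝ fun x : M.Vec S => M.ip x y := by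
  constructor
  · intro x x'
    simp [ip, inner_add_left, Finset.sum_add_distrib]
  · intro c x
    simp [ip, inner_smul_left, Finset.mul_sum]

theorem ip_comm {S : Finset M.Line} (x y : M.Vec S) : M.ip x y = M.ip y x :=
  Finset.sum_congr rfl fun _ _ => real_inner_comm _ _

theorem convexOn_normSq (S : Finset M.Line) :
    ConvexOn ℝ Set.univ fun x : M.Vec S => M.normSq x := by
  have h : (fun x : M.Vec S => M.normSq x) = ∑ e, fun x : M.Vec S => ‖x e‖ ^ 2 := by
    ext x; simp [normSq]
  rw [h]
  refine Finset.sum_induction _ (ConvexOn ℝ Set.univ) (fun _ _ => ConvexOn.add)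
    (convexOn_const 0 convex_univ) fun e _ => ?_
  exact ((convexOn_norm convex_univ).comp_linearMap
    (LinearMap.proj e : M.Vec S →ₗ[ℝ] M.LineVec e.1)).pow (fun _ _ => norm_nonneg _) 2

theorem convexOn_areaObj (hCarea : ∀ ℓ, ConvexOn ℝ Set.univ (Carea ℓ))
    (hlam : ∀ e, 0 ≤ lam e) (hκ : 0 < κ) (X : M.State) (ℓ : Fin L) :
    ConvexOn ℝ Set.univ (M.areaObj Carea lam κ X ℓ) := by
  refine (convexOn_areaCost hCarea hlam ℓ).add ?_
  have h : (fun x : M.AreaVar ℓ => ∑ j ∈ M.neighbors ℓ,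
      (M.ip (X.γ ℓ j) (M.sub (M.tie_sub_left ℓ j) x.1)
        + κ / 2 * M.normSq (M.sub (M.tie_sub_left ℓ j) x.1)
        - κ / 3 * M.ip (M.sub (M.tie_sub_left ℓ j) x.1) (X.ξl ℓ j + X.ξr ℓ j + X.χt ℓ j)))
      = ∑ j ∈ M.neighbors ℓ, fun x : M.AreaVar ℓ =>
        (M.ip (X.γ ℓ j) (M.sub (M.tie_sub_left ℓ j) x.1)
        + κ / 2 * M.normSq (M.sub (M.tie_sub_left ℓ j) x.1)
        - κ / 3 * M.ip (M.sub (M.tie_sub_left ℓ j) x.1) (X.ξl ℓ j + X.ξr ℓ j + X.χt ℓ j)) := by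
    ext x; simp
  rw [h]
  refine Finset.sum_induction _ (ConvexOn ℝ Set.univ) (fun _ _ => ConvexOn.add)
    (convexOn_const 0 convex_univ) fun j _ => ?_
  let f : M.AreaVar ℓ →ₗ[ℝ] M.Vec (M.tie ℓ j) :=
    { toFun := fun x => M.sub (M.tie_sub_left ℓ j) x.1
      map_add' := fun _ _ => rfl
      map_smul' := fun _ _ => rfl }
  have h1 := (((isLinearMap_ip (X.γ ℓ j)).mk').comp f).convexOn convex_univ
  have h2 := (((isLinearMap_ip (X.ξl ℓ j + X.ξr ℓ j + X.χt ℓ j)).mk').comp f).concaveOn convex_univ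
  have h3 := (((convexOn_normSq (M.tie ℓ j)).comp_linearMap f).smul (half_pos hκ).le)
  have h4 := (h1.add h3).sub (h2.smul (div_nonneg hκ.le zero_le_three))
  simp only [ip_comm (X.γ ℓ j)]
  exact h4

theorem convexOn_tieObj (hCtie : ∀ ℓ j, ℓ < j → ConvexOn ℝ Set.univ (Ctie ℓ j))
    (hlam : ∀ e, 0 ≤ lam e) (hκ : 0 < κ) (X : M.State) {ℓ j : Fin L} (hℓj : ℓ < j) :
    ConvexOn ℝ Set.univ (M.tieObj Ctie lam κ X ℓ j) :=
  ((convexOn_tieCost hCtie hlam hℓj).add ((convexOn_normSq _).smul (half_pos hκ).le)).sub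
    (((isLinearMap_ip _).mk').concaveOn convex_univ)

/-- The current limits alone exclude rays. -/
theorem exists_isArgmin_tieObj (hCtie : ∀ ℓ j, ℓ < j → ConvexOn ℝ Set.univ (Ctie ℓ j))
    (hlam : ∀ e, 0 ≤ lam e) (hκ : 0 < κ) (X : M.State) {ℓ j : Fin L} (hℓj : ℓ < j) :
    ∃ χ, IsArgmin (M.tieObj Ctie lam κ X ℓ j) (M.tieFeasibleSet ℓ j) χ := by
  refine exists_isMinOn_of_rays (M.convex_magnitudeSet (M.tie ℓ j))
    (M.isClosed_magnitudeSet (M.tie ℓ j)) (convexOn_tieObj hCtie hlam hκ X hℓj) (a := 0) ?_ ?_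
  · intro e φ
    simp only [magSq, Pi.zero_apply, PiLp.zero_apply]
    nlinarith [sq_nonneg (M.Imax e.1.1)]
  · exact fun d hd => M.eq_zero_of_ray_magnitudeSet fun r hr => (hd r hr).1

/-- DG powers may be unbounded, so compactness is not available. Uniqueness of the centralized
solution replaces it by excluding rays along which the objective does not increase. -/
theorem exists_isArgmin_areaObj {C : M.Var → ℝ}
    (hC : ∀ x : M.Var, C x = (∑ ℓ, Carea ℓ (M.toArea ℓ x))
      + ∑ ℓ, ∑ j with ℓ < j, Ctie ℓ j (M.sub (Finset.subset_univ _) x.1))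
    (hCarea : ∀ ℓ, ConvexOn ℝ Set.univ (Carea ℓ)) (hlam : ∀ e, 0 ≤ lam e) (hκ : 0 < κ)
    {xopt : M.Var} (hopt : M.IsOptimal C lam xopt) (huniq : ∀ y, M.IsOptimal C lam y → y = xopt)
    (X : M.State) (ℓ : Fin L) :
    ∃ x, IsArgmin (M.areaObj Carea lam κ X ℓ) (M.areaFeasibleSet ℓ) x := by
  refine exists_isMinOn_of_rays (M.convex_areaFeasibleSet ℓ) (M.isClosed_areaFeasibleSet ℓ)
    (convexOn_areaObj hCarea hlam hκ X ℓ) (M.toArea_mem_areaFeasibleSet hopt.1 ℓ) ?_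
  intro d hd
  have hd1 : d.1 = 0 := M.eq_zero_of_ray_magnitudeSet fun r hr =>
    (M.mem_areaFeasibleSet.1 (hd r hr).1).2
  -- One unit step suffices. The tie terms depend on currents only and cancel, so the step does not
  -- raise the area's own cost.
  obtain ⟨hmem, hle⟩ := hd 1 zero_le_one
  rw [one_smul] at hmem hle
  have hfst : (M.toArea ℓ xopt + d).1 = (M.toArea ℓ xopt).1 := by
    rw [Prod.fst_add, hd1, add_zero]
  rw [areaObj_eq, areaObj_eq, hfst, add_le_add_iff_right] at hle
  set x₀ := M.toCopies xopt with hx₀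
  have hx₀D := M.toCopies_mem_copyFeasibleSet hopt.1
  -- Only DG powers of area `ℓ` change, so consensus persists and `y` is another optimum of the
  -- consensus form unless `d = 0`.
  set y : M.CopyVar := (Function.update x₀.1 ℓ (M.toArea ℓ xopt + d), x₀.2) with hy
  have hyfst : ∀ j, (y.1 j).1 = (x₀.1 j).1 := by
    intro j
    by_cases hj : j = ℓ
    · subst hj
      simp only [hy, Function.update_self]
      exact hfst
    · simp only [hy, Function.update_of_ne hj]
  have hyD : y ∈ M.copyFeasibleSet := by
    refine ⟨fun j => ?_, hx₀D.2⟩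
    by_cases hj : j = ℓ
    · subst hj
      simpa only [hy, Function.update_self] using hmem
    · simpa only [hy, Function.update_of_ne hj] using hx₀D.1 j
  have hyc : M.copies y ∈ M.consensus := by
    rw [copies_mem_consensus]
    simp only [hyfst]
    exact copies_mem_consensus.1 (M.copies_toCopies xopt)
  have hcost : M.copyCost Carea Ctie lam y ≤ M.copyCost Carea Ctie lam x₀ := by
    refine add_le_add (Finset.sum_le_sum fun j _ => ?_) le_rfl
    by_cases hj : j = ℓ
    · subst hj
      simp only [hy, Function.update_self]
      exact hle
    · simp only [hy, Function.update_of_ne hj, le_refl]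
  have heq := eq_toCopies_of_copyCost_le hC hopt huniq hyD hyc hcost
  have h1 : y.1 ℓ = x₀.1 ℓ := by rw [heq]
  simp only [hy, Function.update_self] at h1
  exact add_eq_left.1 h1

/-- An iteration can be carried out as soon as the subproblems are solvable. -/
theorem exists_step (X : M.State)
    (harea : ∀ ℓ, ∃ x, IsArgmin (M.areaObj Carea lam κ X ℓ) (M.areaFeasibleSet ℓ) x)
    (htie : ∀ ℓ j, ℓ < j → ∃ χ, IsArgmin (M.tieObj Ctie lam κ X ℓ j) (M.tieFeasibleSet ℓ j) χ) :
    ∃ Y, M.Step Carea Ctie lam κ X Y := by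
  choose x hx using harea
  choose χ hχ using htie
  let Y₀ : M.State :=
    { ξ := fun ℓ => (x ℓ).1
      s := fun ℓ => (x ℓ).2
      -- The copies are stored per line but computed per pair `ℓ < j`; the direction of the line
      -- decides which of its ends plays `ℓ`.
      χ := fun e =>
        if h : M.src e.1 < M.tgt e.1 then χ _ _ h ⟨e.1, mem_tie_src_tgt e⟩
        else χ _ _ (lt_of_le_of_ne (not_lt.1 h) (mem_ties.1 e.2).symm) ⟨e.1, mem_tie_tgt_src e⟩
      γ := fun _ _ => 0
      μ := 0 }
  let Y : M.State :=
    { Y₀ with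
      γ := fun ℓ j => X.γ ℓ j + (κ / 3) • ((2 : ℝ) • Y₀.ξl ℓ j - Y₀.ξr ℓ j - Y₀.χt ℓ j)
      μ := fun e => X.μ e + (κ / 3) • (Y₀.ξ _ ⟨e.1, mem_areaLines_src e.1⟩
        + Y₀.ξ _ ⟨e.1, mem_areaLines_tgt e.1⟩ - (2 : ℝ) • Y₀.χ e) }
  have hYχ : ∀ ℓ j (hℓj : ℓ < j), Y.χt ℓ j = χ ℓ j hℓj := by
    intro ℓ j hℓj
    funext e
    obtain ⟨e, he⟩ := e
    rcases (mem_tie.1 he).2 with ⟨rfl, rfl⟩ | ⟨rfl, rfl⟩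
    · exact dif_pos hℓj
    · exact dif_neg hℓj.not_gt
  refine ⟨Y, fun ℓ => hx ℓ, fun ℓ j hℓj => ?_, fun _ _ => rfl, fun ℓ j hℓj => ?_⟩
  · rw [hYχ ℓ j hℓj]
    exact hχ ℓ j hℓj
  · funext e
    obtain ⟨e, he⟩ := e
    rcases (mem_tie.1 he).2 with ⟨rfl, rfl⟩ | ⟨rfl, rfl⟩
    · rfl
    · refine congrArg (fun v => X.μ ⟨e, M.tie_sub_ties _ _ he⟩
        + (κ / 3) • (v - (2 : ℝ) • Y.χ ⟨e, M.tie_sub_ties _ _ he⟩)) (add_comm _ _)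

end Microgrid

/-! ### Feasibility of the iteration and convergence of all iterates. -/

theorem proposition2 {N L K : ℕ} (M : Microgrid N L K)
    (C : M.Var → ℝ)
    (Carea : (ℓ : Fin L) → M.AreaVar ℓ → ℝ)
    (Ctie : (ℓ j : Fin L) → M.Vec (M.tie ℓ j) → ℝ)
    (lam : M.Line → ℝ)
    (hC : ∀ x : M.Var, C x = (∑ ℓ, Carea ℓ (M.toArea ℓ x))
      + ∑ ℓ, ∑ j with ℓ < j, Ctie ℓ j (M.sub (Finset.subset_univ _) x.1))
    (hCarea : ∀ ℓ, ConvexOn ℝ Set.univ (Carea ℓ))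
    (hCtie : ∀ ℓ j, ℓ < j → ConvexOn ℝ Set.univ (Ctie ℓ j))
    (hlam : ∀ e, 0 ≤ lam e)
    (hslater : M.Slater)
    (xopt : M.Var) (hopt : M.IsOptimal C lam xopt)
    (huniq : ∀ y, M.IsOptimal C lam y → y = xopt)
    (κ : ℝ) (hκ : 0 < κ) :
    (∀ X₀ : M.State, X₀.DualZero →
      ∃ X : ℕ → M.State, X 0 = X₀ ∧ ∀ i, M.Step Carea Ctie lam κ (X i) (X (i + 1))) ∧
    ∀ X : ℕ → M.State, (X 0).DualZero →
      (∀ i, M.Step Carea Ctie lam κ (X i) (X (i + 1))) →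
        (∀ ℓ, Tendsto (fun i => ((X i).ξ ℓ, (X i).s ℓ)) atTop (𝓝 (M.toArea ℓ xopt))) ∧
        (∃ χlim, Tendsto (fun i => (X i).χ) atTop (𝓝 χlim)) ∧
        (∃ γlim : (ℓ j : Fin L) → M.Vec (M.tie ℓ j), Tendsto (fun i => (X i).γ) atTop (𝓝 γlim)) ∧
        (∃ μlim, Tendsto (fun i => (X i).μ) atTop (𝓝 μlim)) := by
  constructor
  · intro X₀ _
    choose next hnext using fun X : M.State => Microgrid.exists_step (κ := κ) X
      (Microgrid.exists_isArgmin_areaObj hC hCarea hlam hκ hopt huniq X)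
      (fun _ _ hℓj => Microgrid.exists_isArgmin_tieObj hCtie hlam hκ X hℓj)
    exact ⟨fun i => Nat.rec X₀ (fun _ => next) i, rfl, fun i => hnext _⟩
  · intro X h0 hstep
    obtain ⟨hx, v, hv⟩ := (Microgrid.isADMM_of_step h0 hstep).tendsto M.convex_copyFeasibleSet
      M.isClosed_copyFeasibleSet (Microgrid.convexOn_copyCost hCarea hCtie hlam) hκ
      (M.toCopies_mem_copyFeasibleSet hopt.1) (M.copies_toCopies xopt)
      (fun _ => Microgrid.eq_toCopies_of_copyCost_le hC hopt huniq)
      (Microgrid.exists_consensus_multiplier hC hCarea hCtie hlam hslater hopt)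
    have hcoord : ∀ e k, Tendsto (fun i => (X i).dual e k) atTop (𝓝 (v e k)) := fun e k =>
      ((by fun_prop : Continuous fun h : M.Copies => h e k).tendsto v).comp hv
    refine ⟨fun ℓ => ?_, ⟨_, (continuous_snd.tendsto _).comp hx⟩, ?_, ?_⟩
    · exact ((by fun_prop : Continuous fun x : M.CopyVar => x.1 ℓ).tendsto _).comp hx
    · have hγ : ∀ ℓ j (e : M.tie ℓ j), ∃ a, Tendsto (fun i => (X i).γ ℓ j e) atTop (𝓝 a) := by
        rintro ℓ j ⟨e, he⟩
        have hties := M.tie_sub_ties ℓ j he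
        -- Area `ℓ` holds coordinate 0 of the dual if the line starts there, and coordinate 1 if it
        -- ends there.
        rcases (Microgrid.mem_tie.1 he).2 with ⟨rfl, rfl⟩ | ⟨rfl, rfl⟩
        · exact ⟨_, hcoord ⟨e, hties⟩ 0⟩
        · exact ⟨_, hcoord ⟨e, hties⟩ 1⟩
      choose γlim hγlim using hγ
      exact ⟨γlim, tendsto_pi_nhds.2 fun ℓ => tendsto_pi_nhds.2 fun j =>
        tendsto_pi_nhds.2 fun e => hγlim ℓ j e⟩
    · refine ⟨fun e => -v e 2, tendsto_pi_nhds.2 fun e => ?_⟩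
      refine (hcoord e 2).neg.congr fun i => ?_
      exact neg_neg ((X i).μ e)
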